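/- Let $A\in\mathbb R^{d\times d}$ and consider $\dot u=Au$. For $1\le s\le d$ let $\mathcal G(s,d)$ be the set of $s$-dimensional subspaces of $\mathbb R^d$ and, for $V\in\mathcal G(s,d)$, let $$a_{0,T}(V)=\int_0^T\big\|(I-P_{e^{\tau A}V})\,A\,P_{e^{\tau A}V}\big\|\,d\tau ,$$ where $P_U$ is the orthogonal projection onto $U$ and $\|\cdot\|$ is the spectral norm. The outer angular values of dimension $s$ are $$\vartheta_s^{\sup,\varlimsup}(A)=\sup_{V\in\mathcal G(s,d)}\varlimsup_{T\to\infty}\tfrac1T a_{0,T}(V),\qquad \vartheta_s^{\sup,\varliminf}(A)=\sup_{V\in\mathcal G(s,d)}\varliminf_{T\to\infty}\tfrac1T a_{0,T}(V).$$ Suppose that the real Schur form of $A$ is block diagonal, i.e. there is an orthogonal matrix $Q$ with $QAQ^\top=\mathrm{diag}(\Lambda_1,\dots,\Lambda_k)$, where each $\Lambda_j$ is either the $1\times1$ matrix $\beta_j\in\mathbb R$ or $$\Lambda_j=\begin{pmatrix}\beta_j&-\omega_j/\rho_j\\ \rho_j\omega_j&\beta_j\end{pmatrix},\qquad \omega_j>0,\quad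 0<\rho_j\le1,$$ and $\beta_1\ge\dots\ge\beta_k$. Let $J_{\mathbb C}$ be the set of indices $j$ for which $\Lambda_j$ is $2\times2$. Assume that $J_{\mathbb C}\neq\emptyset$ and that $\beta_j\ne\beta_\nu$ for all $j\in J_{\mathbb C}$ and all $\nu\in\{1,\dots,k\}$ with $\nu\neq j$. Let $$\mathcal J(s,\mathbb C)=\{J\subseteq J_{\mathbb C}:\ |J|\le\min(s,d-s),\ \text{and } s-|J| \text{ is even if } |J_{\mathbb C}|=k\}.$$ (i) For $1\le s\le d-1$, $\vartheta_s^{\sup,\varlimsup}(A)=\vartheta_{d-s}^{\sup,\varlimsup}(A)$ and $\vartheta_s^{\sup,\varliminf}(A)=\vartheta_{d-s}^{\sup,\varliminf}(A)$. (ii) Let $1\le s\le d$. If for every $J\in\mathcal J(s,\mathbb C)$ the numbers $\omega_j$, $j\in J$, are rationally independent (i.e. $\sum_{j\in J}m_j\omega_j=0$ with $m_j\in\mathbb Z$ implies that all $m_j=0$), then $$\vartheta_s^{\sup,\varlimsup}(A)=\vartheta_s^{\sup,\varliminf}(A)=\max_{J\in\mathcal J(s,\mathbb C)}\frac1{\pi^{|J|}}\int_{[0,\pi]^{J}}\max_{j\in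 J}\frac{\rho_j\omega_j}{\cos^2\tau_j+\rho_j^2\sin^2\tau_j}\,d(\tau_j)_{j\in J},$$ where the maximum over $j\in J$ is read as $0$ for $J=\emptyset$. -/

import Mathlib

open Filter Topology MeasureTheory

noncomputable section

namespace AngularValue

/-- The Euclidean space `ℝ^d`. -/
abbrev Vec (d : ℕ) : Type := EuclideanSpace ℝ (Fin d)

/-- The Grassmannian `𝒢(s,d)`: all `s`-dimensional subspaces of `ℝ^d`. -/
abbrev Grassmannian (s d : ℕ) : Type :=
  {V : Submodule ℝ (Vec d) // Module.finrank ℝ V = s}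

/-- The linear operator of `ℝ^d` given by the matrix `A`; its norm is the spectral norm. -/
def op {d : ℕ} (A : Matrix (Fin d) (Fin d) ℝ) : Vec d →L[ℝ] Vec d :=
  Matrix.toEuclideanCLM (n := Fin d) (𝕜 := ℝ) A

/-- The solution operator `Φ(t,0) = exp (t A)` of the autonomous system `u' = A u`. -/
def flow {d : ℕ} (A : Matrix (Fin d) (Fin d) ℝ) (t : ℝ) : Vec d →L[ℝ] Vec d :=
  NormedSpace.exp (t • op A)

/-- The image `Φ(t,0) V` of the subspace `V` under the flow. -/
def flowImage {d : ℕ} (A : Matrix (Fin d) (Fin d) ℝ) (V : Submodule ℝ (Vec d)) (t : ℝ) :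
    Submodule ℝ (Vec d) :=
  V.map (flow A t : Vec d →ₗ[ℝ] Vec d)

/-- The spectral norm `‖(I - P) A P‖`, where `P` is the orthogonal projection
onto `Φ(t,0) V`. -/
def rotationSpeed {d : ℕ} (A : Matrix (Fin d) (Fin d) ℝ) (V : Submodule ℝ (Vec d)) (t : ℝ) : ℝ :=
  ‖(1 - (flowImage A V t).starProjection) * op A * (flowImage A V t).starProjection‖

/-- The quantity `a_{t,T}(V) = ∫_t^T ‖(I - P) A P‖ dτ`. -/
def angularIntegral {d : ℕ} (A : Matrix (Fin d) (Fin d) ℝ) (V : Submodule ℝ (Vec d))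
    (t T : ℝ) : ℝ :=
  ∫ τ in t..T, rotationSpeed A V τ

/-- The outer angular value `ϑ_s^{sup, limsup}(A)`, as an extended real number, so that the
supremum and the upper limit need no side conditions. -/
def outerLimsup {d : ℕ} (A : Matrix (Fin d) (Fin d) ℝ) (s : ℕ) : EReal :=
  ⨆ V : Grassmannian s d,
    limsup (fun T : ℝ => ((1 / T * angularIntegral A V.1 0 T : ℝ) : EReal)) atTop

/-- The outer angular value `ϑ_s^{sup, liminf}(A)`. -/
def outerLiminf {d : ℕ} (A : Matrix (Fin d) (Fin d) ℝ) (s : ℕ) : EReal :=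
  ⨆ V : Grassmannian s d,
    liminf (fun T : ℝ => ((1 / T * angularIntegral A V.1 0 T : ℝ) : EReal)) atTop

/-- The diagonal block of the real Schur form, written uniformly in its size `m ∈ {1, 2}`:
the `1 × 1` matrix `β`, or the `2 × 2` matrix with rows `(β, -ω/ρ)` and `(ρ ω, β)`. -/
def schurBlock (m : ℕ) (β ω ρ : ℝ) : Matrix (Fin m) (Fin m) ℝ :=
  fun a b => if a = b then β else if a < b then -(ω / ρ) else ρ * ω

theorem schurBlock_one (β ω ρ : ℝ) : schurBlock 1 β ω ρ = !![β] := by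
  ext a b
  fin_cases a
  fin_cases b
  simp [schurBlock]

theorem schurBlock_two (β ω ρ : ℝ) :
    schurBlock 2 β ω ρ = !![β, -(ω / ρ); ρ * ω, β] := by
  ext a b
  fin_cases a <;> fin_cases b <;> simp [schurBlock]

/-- `A` has the block-diagonal real Schur form `Q A Qᵀ = diag(Λ_1, …, Λ_k)`, where `Q` is
orthogonal, the block `Λ_j` has size `n j ∈ {1, 2}`, and the real parts `β j` of the eigenvalues
are in non-increasing order.  The rows of `Q` are indexed by the pairs (block, position in the
block); `ω j` and `ρ j` are relevant only for the blocks of size two. -/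
structure IsBlockDiagSchur {d k : ℕ} (A : Matrix (Fin d) (Fin d) ℝ) (n : Fin k → ℕ)
    (β ω ρ : Fin k → ℝ) (Q : Matrix (Σ j, Fin (n j)) (Fin d) ℝ) : Prop where
  size : ∀ j, n j = 1 ∨ n j = 2
  omega_pos : ∀ j, n j = 2 → 0 < ω j
  rho_pos : ∀ j, n j = 2 → 0 < ρ j
  rho_le_one : ∀ j, n j = 2 → ρ j ≤ 1
  ordered : Antitone β
  orth_left : Q * Q.transpose = 1
  orth_right : Q.transpose * Q = 1
  schur : Q * A * Q.transpose =
    Matrix.blockDiagonal' (fun j => schurBlock (n j) (β j) (ω j) (ρ j))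

/-- The set `J_ℂ` of the indices of the `2 × 2` blocks (the nonreal eigenvalues). -/
def complexIndices {k : ℕ} (n : Fin k → ℕ) : Finset (Fin k) :=
  Finset.univ.filter (fun j => n j = 2)

/-- The family `𝒥(s,ℂ)` of the admissible index sets: all `J ⊆ J_ℂ` with
`|J| ≤ min(s, d - s)` and, if all blocks are `2 × 2`, with `s - |J|` even. -/
def admissible {k : ℕ} (d : ℕ) (n : Fin k → ℕ) (s : ℕ) : Finset (Finset (Fin k)) :=
  (complexIndices n).powerset.filter (fun J =>
    J.card ≤ min s (d - s) ∧ ((complexIndices n).card = k → Even (s - J.card)))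

/-- The function `ρ ω / (cos² τ + ρ² sin² τ)`. -/
def ellipseSpeed (ρ ω τ : ℝ) : ℝ :=
  ρ * ω / (Real.cos τ ^ 2 + ρ ^ 2 * Real.sin τ ^ 2)

/-- The mean value `π^{-|J|} ∫_{[0,π]^J} max_{j ∈ J} ρ_j ω_j / (cos² τ_j + ρ_j² sin² τ_j) dτ`.
For `J = ∅` the supremum over the empty index set is `0`, and so is the mean value. -/
def torusMean {k : ℕ} (ω ρ : Fin k → ℝ) (J : Finset (Fin k)) : ℝ :=
  1 / Real.pi ^ J.card *
    ∫ τ in Set.univ.pi (fun _ : J => Set.Icc (0 : ℝ) Real.pi),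
      ⨆ j : J, ellipseSpeed (ρ j) (ω j) (τ j)

end AngularValue

end

/-!
In the coordinates of the real Schur form, the flow of `u' = A u` acts on each real level (the span
of the coordinates whose blocks share a real part, when these blocks have size one) as a scalar, and on
each block of size two as an elliptic rotation followed by a scaling, with a growth rate that no
other block shares.

Gaussian elimination along the flag of decreasing real parts writes a subspace as `V = (1 + R) W`,
where `W` is graded, i.e. the direct sum of its intersections with the levels, and `R` strictly
lowers the real part (`exists_isGraded_map_eq`). The conjugates `exp (t A) R exp (-t A)` then decay
(`tendsto_exp_schurOp_conj`), so that the images of `V` and `W` under the flow, hence their rotation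
speeds, approach each other (`tendsto_speed_evolve_sub`), and `V` may be replaced by `W` in all time
averages.

For a graded `W` the operator `(I - P) A P` splits along the levels. It vanishes on real levels and
on blocks that `W` contains or meets trivially. On a block `j` that `W` meets in a line of phase
`φ j` it has rank one and norm `ρ ω / (cos² τ + ρ² sin² τ)`, with `τ = φ j + ω j * t` at time `t`.
The rotation speed is therefore the maximum of these functions over the set `J` of blocks met in a line
(`HasProfile.speed_eq`). Counting dimensions in `W`, in its orthogonal complement, and modulo two
shows that `J` is admissible (`HasProfile.mem_admissible`); conversely every admissible `J` occurs
with all phases (`exists_hasProfile_of_mem_admissible`). Consequently the outer angular values are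
suprema over admissible sets and phases (`outerLimsup_eq_iSup`, `outerLiminf_eq_iSup`).

The first claim follows because the admissible sets for `s` and `d - s` agree (`admissible_sub`).
For the second, the theorem of Kronecker and Weyl (`tendsto_average_torus`, deduced from the density
of trigonometric polynomials) makes the time average converge to the mean over the torus, for all
phases.
-/

namespace AngularValue

/-! ### The rotation speed of a subspace under a linear operator -/

section Speed

variable {E : Type*} [NormedAddCommGroup E] [InnerProductSpace ℝ E] [FiniteDimensional ℝ E]

/-- The spectral norm `‖(I - P) A P‖`, where `P` is the orthogonal projection onto `W`: the
speed with which the flow of `u' = A u` rotates `W`. -/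
noncomputable def speed (A : E →L[ℝ] E) (W : Submodule ℝ E) : ℝ :=
  ‖(1 - W.starProjection) * A * W.starProjection‖

/-- A perturbation of the identity of size at most `1 / 2` moves a subspace by a comparable
amount, uniformly in the subspace. -/
theorem norm_starProjection_map_one_add_sub_le (W : Submodule ℝ E) (R : E →L[ℝ] E)
    (hR : ‖R‖ ≤ 1 / 2) :
    ‖(W.map ((1 + R : E →L[ℝ] E) : E →ₗ[ℝ] E)).starProjection - W.starProjection‖ ≤ 3 * ‖R‖ := by
  set V := W.map ((1 + R : E →L[ℝ] E) : E →ₗ[ℝ] E) with hV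
  set P := V.starProjection with hP
  set S := W.starProjection with hS
  have h1 : ‖(1 - P) * S‖ ≤ ‖R‖ := by
    refine ContinuousLinearMap.opNorm_le_bound _ (norm_nonneg _) fun x => ?_
    have hm : S x + R (S x) ∈ V :=
      ⟨S x, W.starProjection_apply_mem x, by simp⟩
    have h0 : (1 - P) (S x + R (S x)) = 0 := by
      have := Submodule.starProjection_eq_self_iff.2 hm
      simp only [sub_apply, one_apply_eq_self, hP, this, sub_self]
    have h2 : ((1 - P) * S) x = -((1 - P) (R (S x))) := by
      rw [map_add] at h0
      rw [mul_apply_eq_comp]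
      exact eq_neg_of_add_eq_zero_left h0
    have h3 : (1 - P) = Vᗮ.starProjection := by
      rw [Submodule.starProjection_orthogonal']
    rw [h2, norm_neg, h3]
    calc ‖Vᗮ.starProjection (R (S x))‖ ≤ 1 * ‖R (S x)‖ :=
          ContinuousLinearMap.le_of_opNorm_le _ (Submodule.starProjection_norm_le _) _
      _ ≤ ‖R‖ * ‖S x‖ := by rw [one_mul]; exact R.le_opNorm _
      _ ≤ ‖R‖ * (1 * ‖x‖) := by
          gcongr
          exact ContinuousLinearMap.le_of_opNorm_le _ (Submodule.starProjection_norm_le _) _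
      _ = ‖R‖ * ‖x‖ := by ring
  have h2 : ‖(1 - S) * P‖ ≤ 2 * ‖R‖ := by
    refine ContinuousLinearMap.opNorm_le_bound _ (by positivity) fun x => ?_
    obtain ⟨w, hw, hwx⟩ := V.starProjection_apply_mem x
    have hwx' : w + R w = P x := by simpa using hwx
    have h0 : (1 - S) w = 0 := by
      have := Submodule.starProjection_eq_self_iff.2 hw
      simp only [sub_apply, one_apply_eq_self, hS, this, sub_self]
    have h3 : ((1 - S) * P) x = (1 - S) (R w) := by
      rw [mul_apply_eq_comp, ← hwx', map_add, h0, zero_add]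
    have h4 : (1 - S) = Wᗮ.starProjection := by
      rw [Submodule.starProjection_orthogonal']
    have h5 : ‖R w‖ ≤ ‖R‖ * ‖w‖ := R.le_opNorm _
    have h6 : ‖w‖ ≤ 2 * ‖P x‖ := by
      have h7 : ‖w‖ ≤ ‖P x‖ + ‖R w‖ := by
        rw [← hwx']
        have := norm_sub_le (w + R w) (R w)
        simpa using this
      nlinarith [norm_nonneg w]
    have h8 : ‖P x‖ ≤ ‖x‖ := by
      simpa using ContinuousLinearMap.le_of_opNorm_le _ (Submodule.starProjection_norm_le V) x
    rw [h3, h4]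
    calc ‖Wᗮ.starProjection (R w)‖ ≤ 1 * ‖R w‖ :=
          ContinuousLinearMap.le_of_opNorm_le _ (Submodule.starProjection_norm_le _) _
      _ ≤ ‖R‖ * (2 * ‖x‖) := by
          rw [one_mul]
          refine h5.trans ?_
          gcongr
          linarith
      _ = 2 * ‖R‖ * ‖x‖ := by ring
  -- `P (1 - S)` is the adjoint of `(1 - S) P`
  have h3 : ‖P * (1 - S)‖ ≤ 2 * ‖R‖ := by
    have hPs : star P = P := isSelfAdjoint_starProjection V
    have hSs : star S = S := isSelfAdjoint_starProjection W
    have : P * (1 - S) = star ((1 - S) * P) := by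
      rw [star_mul, star_sub, star_one, hPs, hSs]
    rw [this, ContinuousLinearMap.star_eq_adjoint, LinearIsometryEquiv.norm_map]
    exact h2
  have h4 : P - S = P * (1 - S) - (1 - P) * S := by noncomm_ring
  rw [h4]
  refine (norm_sub_le _ _).trans ?_
  linarith

theorem abs_speed_sub_speed_le (A : E →L[ℝ] E) (V W : Submodule ℝ E) :
    |speed A V - speed A W| ≤ 2 * ‖A‖ * ‖V.starProjection - W.starProjection‖ := by
  refine (abs_norm_sub_norm_le _ _).trans ?_
  set P := V.starProjection with hP
  set S := W.starProjection with hS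
  have h : (1 - P) * A * P - (1 - S) * A * S = (1 - P) * A * (P - S) - (P - S) * A * S := by
    noncomm_ring
  have h1 : ‖1 - P‖ ≤ 1 := by
    rw [hP, ← Submodule.starProjection_orthogonal']
    exact Submodule.starProjection_norm_le _
  have h2 : ‖S‖ ≤ 1 := Submodule.starProjection_norm_le _
  rw [h]
  calc ‖(1 - P) * A * (P - S) - (P - S) * A * S‖
      ≤ ‖(1 - P) * A * (P - S)‖ + ‖(P - S) * A * S‖ := norm_sub_le _ _
    _ ≤ ‖1 - P‖ * ‖A‖ * ‖P - S‖ + ‖P - S‖ * ‖A‖ * ‖S‖ := by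
        gcongr <;> exact norm_mul₃_le
    _ ≤ 1 * ‖A‖ * ‖P - S‖ + ‖P - S‖ * ‖A‖ * 1 := by gcongr
    _ = 2 * ‖A‖ * ‖P - S‖ := by ring

/-- The orthogonal projection onto `(1 + R) W` tends to that onto `W` as `R → 0`; hence so do the
rotation speeds, even for varying `W`. -/
theorem tendsto_speed_sub_speed {α : Type*} {l : Filter α} (A : E →L[ℝ] E)
    {V W : α → Submodule ℝ E} {R : α → E →L[ℝ] E} (hR : Tendsto R l (𝓝 0))
    (hV : ∀ a, V a = (W a).map ((1 + R a : E →L[ℝ] E) : E →ₗ[ℝ] E)) :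
    Tendsto (fun a => speed A (V a) - speed A (W a)) l (𝓝 0) := by
  have hn : Tendsto (fun a => ‖R a‖) l (𝓝 0) := by simpa using hR.norm
  have hlim : Tendsto (fun a => 2 * ‖A‖ * (3 * ‖R a‖)) l (𝓝 0) := by
    simpa using (hn.const_mul 3).const_mul (2 * ‖A‖)
  refine squeeze_zero_norm' ?_ hlim
  filter_upwards [hn.eventually (ge_mem_nhds (show (0 : ℝ) < 1 / 2 by norm_num))] with a ha
  rw [Real.norm_eq_abs]
  refine (abs_speed_sub_speed_le A _ _).trans ?_
  gcongr
  rw [hV a]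
  exact norm_starProjection_map_one_add_sub_le _ _ ha

/-- The image of a subspace under the flow `exp (t A)`. -/
noncomputable def evolve (A : E →L[ℝ] E) (W : Submodule ℝ E) (t : ℝ) : Submodule ℝ E :=
  W.map ((NormedSpace.exp (t • A) : E →L[ℝ] E) : E →ₗ[ℝ] E)

theorem exp_smul_mul_exp_smul (A : E →L[ℝ] E) (s t : ℝ) :
    NormedSpace.exp (s • A) * NormedSpace.exp (t • A) = NormedSpace.exp ((s + t) • A) := by
  let _ : NormedAlgebra ℚ (E →L[ℝ] E) := NormedAlgebra.restrictScalars ℚ ℝ _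
  rw [add_smul, NormedSpace.exp_add_of_commute]
  exact ((Commute.refl A).smul_left s).smul_right t

theorem exp_smul_add_of_commute {A B : E →L[ℝ] E} (h : Commute A B) (t : ℝ) :
    NormedSpace.exp (t • (A + B)) = NormedSpace.exp (t • A) * NormedSpace.exp (t • B) := by
  let _ : NormedAlgebra ℚ (E →L[ℝ] E) := NormedAlgebra.restrictScalars ℚ ℝ _
  rw [smul_add, NormedSpace.exp_add_of_commute]
  exact (h.smul_left t).smul_right t

theorem apply_exp_smul_of_commute {E : Type*} [NormedAddCommGroup E] [NormedSpace ℝ E]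
    [CompleteSpace E] {A L : E →L[ℝ] E} (h : Commute L A) (t : ℝ) (x : E) :
    L (NormedSpace.exp (t • A) x) = NormedSpace.exp (t • A) (L x) := by
  let _ : NormedAlgebra ℚ (E →L[ℝ] E) := NormedAlgebra.restrictScalars ℚ ℝ _
  exact DFunLike.congr_fun (h.smul_right t).exp_right.eq x

theorem exp_neg_smul_apply_exp_smul (A : E →L[ℝ] E) (t : ℝ) (x : E) :
    NormedSpace.exp (-t • A) (NormedSpace.exp (t • A) x) = x := by
  rw [← mul_apply_eq_comp, exp_smul_mul_exp_smul]
  simp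

theorem exp_smul_apply_exp_neg_smul (A : E →L[ℝ] E) (t : ℝ) (x : E) :
    NormedSpace.exp (t • A) (NormedSpace.exp (-t • A) x) = x := by
  rw [← mul_apply_eq_comp, exp_smul_mul_exp_smul]
  simp

theorem continuous_exp_smul (A : E →L[ℝ] E) :
    Continuous fun t : ℝ => NormedSpace.exp (t • A) :=
  continuous_iff_continuousAt.2 fun t => (hasDerivAt_exp_smul_const (𝕂 := ℝ) A t).continuousAt

theorem continuous_speed_evolve (A : E →L[ℝ] E) (V : Submodule ℝ E) :
    Continuous fun t => speed A (evolve A V t) := by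
  refine continuous_iff_continuousAt.2 fun t => ?_
  have hR : Tendsto (fun s : ℝ => NormedSpace.exp ((s - t) • A) - 1) (𝓝 t) (𝓝 0) := by
    have hc : Continuous fun s : ℝ => NormedSpace.exp ((s - t) • A) - 1 :=
      ((continuous_exp_smul A).comp (continuous_id.sub continuous_const)).sub continuous_const
    simpa using hc.tendsto t
  have h := tendsto_speed_sub_speed A (V := fun s => evolve A V s) (W := fun _ => evolve A V t)
    hR fun s => by
      rw [evolve, evolve, ← Submodule.map_comp]
      congr 1
      ext x
      have : NormedSpace.exp (s • A) = NormedSpace.exp ((s - t) • A) * NormedSpace.exp (t • A) := by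
        rw [exp_smul_mul_exp_smul, sub_add_cancel]
      simp [this]
  have h' := h.add_const (speed A (evolve A V t))
  simpa [ContinuousAt] using h'

/-- A solution of `u' = A u` is the orbit of its initial value under the flow. -/
theorem exp_smul_apply_eq_of_hasDerivAt (A : E →L[ℝ] E) {u : ℝ → E}
    (hu : ∀ t, HasDerivAt u (A (u t)) t) (t : ℝ) : NormedSpace.exp (t • A) (u 0) = u t := by
  have hd : ∀ s, HasDerivAt (fun s : ℝ => NormedSpace.exp (-s • A) (u s)) 0 s := by
    intro s
    have h1 := (hasDerivAt_exp_smul_const (𝕂 := ℝ) A (-s)).scomp s (hasDerivAt_neg s)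
    have h2 := h1.clm_apply (hu s)
    refine h2.congr_deriv ?_
    simp
  have hc := is_const_of_deriv_eq_zero (fun s => (hd s).differentiableAt)
    (fun s => (hd s).deriv) t 0
  have h0 : NormedSpace.exp (-t • A) (u t) = u 0 := by simpa using hc
  rw [← h0, exp_smul_apply_exp_neg_smul]

/-- If `V = (1 + R) W` and the conjugates `exp (t A) R exp (-t A)` decay, then `V` and `W` have
asymptotically the same rotation speed under the flow. -/
theorem tendsto_speed_evolve_sub (A R : E →L[ℝ] E) {V W : Submodule ℝ E}
    (hV : V = W.map ((1 + R : E →L[ℝ] E) : E →ₗ[ℝ] E))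
    (hR : Tendsto (fun t : ℝ => NormedSpace.exp (t • A) * R * NormedSpace.exp (-t • A))
      atTop (𝓝 0)) :
    Tendsto (fun t => speed A (evolve A V t) - speed A (evolve A W t)) atTop (𝓝 0) := by
  refine tendsto_speed_sub_speed A hR fun t => ?_
  rw [evolve, evolve, hV, ← Submodule.map_comp, ← Submodule.map_comp]
  congr 1
  ext x
  have := exp_neg_smul_apply_exp_smul A t x
  simp only [neg_smul] at this
  simp [this]

theorem starProjection_map_linearIsometryEquiv {F : Type*} [NormedAddCommGroup F]
    [InnerProductSpace ℝ F] [FiniteDimensional ℝ F] (Φ : E ≃ₗᵢ[ℝ] F) (W : Submodule ℝ E) (x : E) :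
    (W.map (Φ.toLinearEquiv : E →ₗ[ℝ] F)).starProjection (Φ x) = Φ (W.starProjection x) := by
  have := Submodule.starProjection_map_apply Φ W (Φ x)
  simpa using this

/-- The rotation speed is invariant under orthogonal changes of coordinates. -/
theorem speed_map_linearIsometryEquiv {F : Type*} [NormedAddCommGroup F]
    [InnerProductSpace ℝ F] [FiniteDimensional ℝ F] (Φ : E ≃ₗᵢ[ℝ] F) {A : E →L[ℝ] E}
    {B : F →L[ℝ] F} (hAB : ∀ x, Φ (A x) = B (Φ x)) (W : Submodule ℝ E) :
    speed B (W.map (Φ.toLinearEquiv : E →ₗ[ℝ] F)) = speed A W := by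
  have key : ∀ x, ((1 - (W.map (Φ.toLinearEquiv : E →ₗ[ℝ] F)).starProjection) * B *
      (W.map (Φ.toLinearEquiv : E →ₗ[ℝ] F)).starProjection) (Φ x) =
      Φ (((1 - W.starProjection) * A * W.starProjection) x) := by
    intro x
    simp only [mul_apply_eq_comp, sub_apply, one_apply_eq_self,
      starProjection_map_linearIsometryEquiv, ← hAB, map_sub]
  refine le_antisymm ?_ ?_
  · refine ContinuousLinearMap.opNorm_le_bound _ (norm_nonneg _) fun y => ?_
    obtain ⟨x, rfl⟩ := Φ.surjective y
    rw [key, Φ.norm_map, Φ.norm_map]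
    exact ContinuousLinearMap.le_opNorm _ _
  · refine ContinuousLinearMap.opNorm_le_bound _ (norm_nonneg _) fun x => ?_
    rw [← Φ.norm_map, ← key, ← Φ.norm_map x]
    exact ContinuousLinearMap.le_opNorm _ _

theorem map_evolve_linearIsometryEquiv {F : Type*} [NormedAddCommGroup F]
    [InnerProductSpace ℝ F] [FiniteDimensional ℝ F] (Φ : E ≃ₗᵢ[ℝ] F) {A : E →L[ℝ] E}
    {B : F →L[ℝ] F} (hAB : ∀ x, Φ (A x) = B (Φ x)) (W : Submodule ℝ E) (t : ℝ) :
    (evolve A W t).map (Φ.toLinearEquiv : E →ₗ[ℝ] F) =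
      evolve B (W.map (Φ.toLinearEquiv : E →ₗ[ℝ] F)) t := by
  have key : ∀ x, NormedSpace.exp (t • B) (Φ x) = Φ (NormedSpace.exp (t • A) x) := by
    intro x
    have hd : ∀ s, HasDerivAt (fun s : ℝ => Φ (NormedSpace.exp (s • A) x))
        (B (Φ (NormedSpace.exp (s • A) x))) s := by
      intro s
      have h1 := (hasDerivAt_exp_smul_const' (𝕂 := ℝ) A s).clm_apply (hasDerivAt_const s x)
      have h2 := (Φ.toContinuousLinearEquiv.toContinuousLinearMap.hasFDerivAt).comp_hasDerivAt s h1
      refine h2.congr_deriv ?_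
      simp [hAB]
    simpa using exp_smul_apply_eq_of_hasDerivAt B hd t
  rw [evolve, evolve, ← Submodule.map_comp, ← Submodule.map_comp]
  congr 1
  ext x
  simp [key]

/-- The operator norm of a diagonal operator between two orthonormal systems. -/
theorem norm_sum_smulRight_eq_iSup {E : Type*} [NormedAddCommGroup E] [InnerProductSpace ℝ E]
    {κ : Type*} [Fintype κ] {u w : κ → E} (hu : Orthonormal ℝ u)
    (hw : Orthonormal ℝ w) {c : κ → ℝ} (hc : ∀ i, 0 ≤ c i) (T : E →L[ℝ] E)
    (hT : ∀ x, T x = ∑ i, (c i * inner ℝ (u i) x) • w i) : ‖T‖ = ⨆ i, c i := by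
  have hbdd : BddAbove (Set.range c) := (Set.finite_range c).bddAbove
  have h0 : 0 ≤ ⨆ i, c i := Real.iSup_nonneg hc
  refine le_antisymm ?_ ?_
  · refine ContinuousLinearMap.opNorm_le_bound _ h0 fun x => ?_
    refine le_of_sq_le_sq ?_ (by positivity)
    have h1 : ‖T x‖ ^ 2 = ∑ i, (c i * inner ℝ (u i) x) ^ 2 := by
      rw [hT, ← real_inner_self_eq_norm_sq, hw.inner_sum]
      simp [sq]
    rw [h1, mul_pow]
    have h2 := hu.sum_inner_products_le x (s := Finset.univ)
    calc ∑ i, (c i * inner ℝ (u i) x) ^ 2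
        ≤ ∑ i, (⨆ i, c i) ^ 2 * ‖(inner ℝ (u i) x : ℝ)‖ ^ 2 := by
          refine Finset.sum_le_sum fun i _ => ?_
          rw [mul_pow, Real.norm_eq_abs, sq_abs]
          gcongr
          · exact hc i
          · exact le_ciSup hbdd i
      _ ≤ (⨆ i, c i) ^ 2 * ‖x‖ ^ 2 := by
          rw [← Finset.mul_sum]
          gcongr
  · refine Real.iSup_le (fun i => ?_) (norm_nonneg _)
    classical
    have h1 : T (u i) = c i • w i := by
      rw [hT, Finset.sum_eq_single i]
      · rw [real_inner_self_eq_norm_sq, hu.1 i]; simp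
      · intro j _ hj
        rw [hu.2 hj]; simp
      · simp
    have h2 := T.le_opNorm (u i)
    rwa [h1, norm_smul, hw.1 i, hu.1 i, mul_one, mul_one, Real.norm_eq_abs,
      abs_of_nonneg (hc i)] at h2

end Speed

/-! ### Time averages -/

/-- The time averages of a continuous function that tends to `0` tend to `0`. -/
theorem tendsto_average_of_tendsto_zero {f : ℝ → ℝ} (hf : Continuous f)
    (h0 : Tendsto f atTop (𝓝 0)) :
    Tendsto (fun T : ℝ => 1 / T * ∫ t in (0 : ℝ)..T, f t) atTop (𝓝 0) := by
  rw [Metric.tendsto_atTop]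
  intro ε hε
  obtain ⟨S, hS⟩ := Metric.tendsto_atTop.1 h0 (ε / 2) (by positivity)
  set S' := max S 1 with hS'
  set C := |∫ t in (0 : ℝ)..S', f t| with hC
  refine ⟨max (S' + 1) (2 * C / ε + 1), fun T hT => ?_⟩
  have hT1 : S' < T := lt_of_lt_of_le (by linarith) ((le_max_left _ _).trans hT)
  have hT0 : 0 < T := lt_of_lt_of_le (by positivity) hT1.le
  have hT2 : 2 * C / ε < T := lt_of_lt_of_le (by linarith) ((le_max_right _ _).trans hT)
  have hsplit : ∫ t in (0 : ℝ)..T, f t = (∫ t in (0 : ℝ)..S', f t) + ∫ t in S'..T, f t :=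
    (intervalIntegral.integral_add_adjacent_intervals (hf.intervalIntegrable _ _)
      (hf.intervalIntegrable _ _)).symm
  have h1 : |∫ t in S'..T, f t| ≤ ε / 2 * (T - S') := by
    have := intervalIntegral.norm_integral_le_of_norm_le_const (a := S') (b := T) (f := f)
      (C := ε / 2) fun x hx => by
        rw [Set.uIoc_of_le hT1.le] at hx
        have := hS x ((le_max_left _ _).trans hx.1.le)
        rw [dist_zero_right] at this
        exact this.le
    rwa [Real.norm_eq_abs, abs_of_pos (sub_pos.2 hT1)] at this
  have h2 : C < ε / 2 * T := by
    rw [div_lt_iff₀ hε] at hT2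
    linarith
  have h3 : (1 : ℝ) ≤ S' := le_max_right _ _
  rw [dist_zero_right, norm_mul, Real.norm_eq_abs, Real.norm_eq_abs, abs_of_pos (by positivity),
    one_div, inv_mul_lt_iff₀ hT0, hsplit]
  refine (abs_add_le _ _).trans_lt ?_
  nlinarith

theorem limsup_coe_le_of_tendsto_sub {α : Type*} {l : Filter α} [l.NeBot] {f g : α → ℝ}
    (h : Tendsto (fun a => f a - g a) l (𝓝 0)) :
    limsup (fun a => (f a : EReal)) l ≤ limsup (fun a => (g a : EReal)) l := by
  have h0 : limsup (fun a => ((f a - g a : ℝ) : EReal)) l = 0 :=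
    ((continuous_coe_real_ereal.tendsto 0).comp h).limsup_eq
  have h1 : (fun a => (f a : EReal)) =
      (fun a => (g a : EReal)) + fun a => ((f a - g a : ℝ) : EReal) := by
    ext a
    rw [Pi.add_apply, ← EReal.coe_add]
    congr 1
    ring
  rw [h1]
  refine (EReal.limsup_add_le (.inr ?_) (.inr ?_)).trans ?_ <;> rw [h0] <;> simp

theorem liminf_coe_le_of_tendsto_sub {α : Type*} {l : Filter α} [l.NeBot] {f g : α → ℝ}
    (h : Tendsto (fun a => f a - g a) l (𝓝 0)) :
    liminf (fun a => (g a : EReal)) l ≤ liminf (fun a => (f a : EReal)) l := by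
  have h0 : liminf (fun a => ((f a - g a : ℝ) : EReal)) l = 0 :=
    ((continuous_coe_real_ereal.tendsto 0).comp h).liminf_eq
  have h1 : (fun a => (f a : EReal)) =
      (fun a => (g a : EReal)) + fun a => ((f a - g a : ℝ) : EReal) := by
    ext a
    rw [Pi.add_apply, ← EReal.coe_add]
    congr 1
    ring
  rw [h1]
  refine le_trans ?_ EReal.le_liminf_add
  rw [h0]; simp

theorem tendsto_neg_sub {α : Type*} {l : Filter α} {f g : α → ℝ}
    (h : Tendsto (fun a => f a - g a) l (𝓝 0)) : Tendsto (fun a => g a - f a) l (𝓝 0) := by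
  simpa using h.neg

theorem limsup_coe_eq_of_tendsto_sub {α : Type*} {l : Filter α} [l.NeBot] {f g : α → ℝ}
    (h : Tendsto (fun a => f a - g a) l (𝓝 0)) :
    limsup (fun a => (f a : EReal)) l = limsup (fun a => (g a : EReal)) l :=
  le_antisymm (limsup_coe_le_of_tendsto_sub h) (limsup_coe_le_of_tendsto_sub (tendsto_neg_sub h))

theorem liminf_coe_eq_of_tendsto_sub {α : Type*} {l : Filter α} [l.NeBot] {f g : α → ℝ}
    (h : Tendsto (fun a => f a - g a) l (𝓝 0)) :
    liminf (fun a => (f a : EReal)) l = liminf (fun a => (g a : EReal)) l :=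
  le_antisymm (liminf_coe_le_of_tendsto_sub (tendsto_neg_sub h)) (liminf_coe_le_of_tendsto_sub h)

/-! ### Subspaces graded by the levels of a weight -/

section Grading

variable {ι : Type*}

/-- The projection of `ℝ^ι` onto the span of the coordinate vectors of weight `b`, where `β`
assigns a weight to each coordinate. -/
noncomputable def level (β : ι → ℝ) (b : ℝ) : EuclideanSpace ℝ ι →ₗ[ℝ] EuclideanSpace ℝ ι where
  toFun x := WithLp.toLp 2 fun i => if β i = b then x i else 0
  map_add' x y := by
    ext i
    by_cases h : β i = b <;> simp [h]
  map_smul' c x := by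
    ext i
    by_cases h : β i = b <;> simp [h]

@[simp]
theorem level_apply (β : ι → ℝ) (b : ℝ) (x : EuclideanSpace ℝ ι) (i : ι) :
    level β b x i = if β i = b then x i else 0 := rfl

theorem level_level (β : ι → ℝ) (b c : ℝ) (x : EuclideanSpace ℝ ι) :
    level β b (level β c x) = if b = c then level β c x else 0 := by
  ext i
  split_ifs with h
  · by_cases hi : β i = b <;> simp_all
  · by_cases hi : β i = b <;> simp [hi, h]

theorem inner_level_left [Fintype ι] (β : ι → ℝ) (b : ℝ) (x y : EuclideanSpace ℝ ι) :
    inner ℝ (level β b x) y = inner ℝ x (level β b y) := by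
  simp only [PiLp.inner_apply, level_apply]
  refine Finset.sum_congr rfl fun i _ => ?_
  split_ifs <;> simp

/-- A subspace is graded if it is the direct sum of its intersections with the levels. -/
def IsGraded (β : ι → ℝ) (W : Submodule ℝ (EuclideanSpace ℝ ι)) : Prop :=
  ∀ b, ∀ x ∈ W, level β b x ∈ W

/-- Gaussian elimination from the top level downwards: every subspace is the image of a graded one
under `1 + R`, where `R` strictly lowers the weight. -/
theorem exists_isGraded_map_eq [Fintype ι] [DecidableEq ι] (β : ι → ℝ) (S : Finset ℝ) :
    ∀ V : Submodule ℝ (EuclideanSpace ℝ ι), (∀ x ∈ V, ∀ i, β i ∉ S → x i = 0) →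
      ∃ (W : Submodule ℝ (EuclideanSpace ℝ ι))
        (R : EuclideanSpace ℝ ι →ₗ[ℝ] EuclideanSpace ℝ ι),
        IsGraded β W ∧ (∀ x ∈ W, ∀ i, β i ∉ S → x i = 0) ∧
        (∀ i l, β l ≤ β i → R (EuclideanSpace.single l 1) i = 0) ∧
        V = W.map (1 + R) := by
  induction S using Finset.induction_on_max with
  | empty =>
    intro V hV
    have hV0 : V = ⊥ := (Submodule.eq_bot_iff V).2 fun x hx => by
      ext i
      exact hV x hx i (by simp)
    exact ⟨⊥, 0, fun b x hx => by simp_all, by simp_all, by simp, by simp [hV0]⟩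
  | insert b S hS ih =>
    intro V hV
    have hbS : b ∉ S := fun h => lt_irrefl b (hS b h)
    obtain ⟨W', R', hW', hW'S, hR', hVW'⟩ := ih (V ⊓ LinearMap.ker (level β b)) (by
      rintro x ⟨hxV, hxk⟩ i hi
      by_cases hib : β i = b
      · have := congrArg (fun y : EuclideanSpace ℝ ι => y i) (LinearMap.mem_ker.1 hxk)
        simpa [hib] using this
      · exact hV x hxV i (by simp [hib, hi]))
    set f : V →ₗ[ℝ] EuclideanSpace ℝ ι := level β b ∘ₗ V.subtype with hf
    set U := LinearMap.range f with hU
    obtain ⟨g, hg⟩ := f.rangeRestrict.exists_rightInverse_of_surjective f.range_rangeRestrict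
    have hg' : ∀ y : U, level β b (g y : EuclideanSpace ℝ ι) = y := fun y =>
      congrArg Subtype.val (LinearMap.congr_fun hg y)
    have hUb : ∀ y ∈ U, level β b y = y := by
      rintro _ ⟨x, rfl⟩
      simp [hf, level_level]
    have hW'b : ∀ w ∈ W', level β b w = 0 := by
      intro w hw
      ext i
      by_cases hib : β i = b
      · simp [hib, hW'S w hw i (by rwa [hib])]
      · simp [hib]
    set P : EuclideanSpace ℝ ι →ₗ[ℝ] U :=
      U.orthogonalProjectionOnto.toLinearMap with hP
    have hPU : ∀ y : U, P y = y := fun y => by simp [hP]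
    set R : EuclideanSpace ℝ ι →ₗ[ℝ] EuclideanSpace ℝ ι :=
      R' ∘ₗ (1 - level β b) + (V.subtype ∘ₗ g ∘ₗ P - U.subtype ∘ₗ P) ∘ₗ level β b with hR
    have hRW' : ∀ w ∈ W', (1 + R) w = (1 + R') w := by
      intro w hw
      simp [hR, hW'b w hw]
    have hRU : ∀ y : U, (1 + R) (y : EuclideanSpace ℝ ι) = g y := by
      intro y
      simp [hR, hUb y y.2, hPU]
    refine ⟨W' ⊔ U, R, ?_, ?_, ?_, ?_⟩
    · intro c x hx
      obtain ⟨w, hw, y, hy, rfl⟩ := Submodule.mem_sup.1 hx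
      rw [map_add]
      refine add_mem (Submodule.mem_sup_left (hW' c w hw)) (Submodule.mem_sup_right ?_)
      rw [← hUb y hy, level_level]
      split_ifs
      · rwa [hUb y hy]
      · exact zero_mem _
    · intro x hx i hi
      obtain ⟨w, hw, y, hy, rfl⟩ := Submodule.mem_sup.1 hx
      simp only [Finset.mem_insert, not_or] at hi
      rw [PiLp.add_apply, hW'S w hw i hi.2, ← hUb y hy]
      simp [hi.1]
    · intro i l hil
      by_cases hl : β l = b
      · have h1 : level β b (EuclideanSpace.single l (1 : ℝ)) = EuclideanSpace.single l 1 := by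
          ext m
          by_cases hm : m = l
          · simp [hm, hl]
          · simp [hm]
        set y := P (EuclideanSpace.single l 1) with hy
        have h2 : R (EuclideanSpace.single l 1) = (g y : EuclideanSpace ℝ ι) - y := by
          simp [hR, h1, hy]
        have h3 : level β b (y : EuclideanSpace ℝ ι) = y := hUb y y.2
        rw [h2, PiLp.sub_apply]
        by_cases hi : β i = b
        · have h4 := congrArg (fun z : EuclideanSpace ℝ ι => z i) (hg' y)
          simp only [level_apply, hi, if_true] at h4
          rw [h4, sub_self]
        · -- weights above the top level do not occur in `V`
          have hib : b < β i := lt_of_le_of_ne (hl ▸ hil) (Ne.symm hi)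
          have h5 : (g y : EuclideanSpace ℝ ι) i = 0 := hV _ (g y).2 i (by
            simp only [Finset.mem_insert, not_or]
            exact ⟨hi, fun h => lt_asymm hib (hS _ h)⟩)
          rw [h5, ← h3]
          simp [hi]
      · have h1 : level β b (EuclideanSpace.single l (1 : ℝ)) = 0 := by
          ext m
          by_cases hm : m = l
          · simp [hm, hl]
          · simp [hm]
        simp [hR, h1, hR' i l hil]
    · refine le_antisymm ?_ ?_
      · intro v hv
        set y : U := ⟨f ⟨v, hv⟩, LinearMap.mem_range_self _ _⟩ with hy
        have h1 : v - g y ∈ V ⊓ LinearMap.ker (level β b) := by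
          refine Submodule.mem_inf.2 ⟨sub_mem hv (g y).2, ?_⟩
          rw [LinearMap.mem_ker, map_sub, hg', sub_eq_zero]
          rfl
        rw [hVW'] at h1
        obtain ⟨w, hw, hwv⟩ := h1
        refine ⟨w + y, add_mem (Submodule.mem_sup_left hw) (Submodule.mem_sup_right y.2), ?_⟩
        rw [map_add, hRW' w hw, hwv, hRU, sub_add_cancel]
      · rw [Submodule.map_sup, sup_le_iff]
        constructor
        · rintro _ ⟨w, hw, rfl⟩
          rw [hRW' w hw]
          have : (1 + R') w ∈ V ⊓ LinearMap.ker (level β b) := hVW' ▸ ⟨w, hw, rfl⟩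
          exact this.1
        · rintro _ ⟨y, hy, rfl⟩
          rw [hRU ⟨y, hy⟩]
          exact (g _).2

theorem euclidean_eq_sum_single [Fintype ι] [DecidableEq ι] (x : EuclideanSpace ℝ ι) :
    x = ∑ l, x l • EuclideanSpace.single l (1 : ℝ) := by
  ext i
  simp [Finset.sum_apply, Pi.single_apply]

/-- A unipotent map `1 + R` is injective: the top-weight coordinates of `x` and `x + R x`
agree. -/
theorem injective_one_add_of_lowers [Fintype ι] [DecidableEq ι] {β : ι → ℝ}
    {R : EuclideanSpace ℝ ι →ₗ[ℝ] EuclideanSpace ℝ ι}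
    (hR : ∀ i l, β l ≤ β i → R (EuclideanSpace.single l 1) i = 0) :
    Function.Injective (1 + R : EuclideanSpace ℝ ι →ₗ[ℝ] EuclideanSpace ℝ ι) := by
  rw [← LinearMap.ker_eq_bot, LinearMap.ker_eq_bot']
  intro x hx
  by_contra hne
  have hs : (Finset.univ.filter fun i => x i ≠ 0).Nonempty := by
    by_contra h
    rw [Finset.not_nonempty_iff_eq_empty, Finset.filter_eq_empty_iff] at h
    exact hne (by ext i; simpa using h (Finset.mem_univ i))
  obtain ⟨l, hl, hmax⟩ := Finset.exists_max_image _ β hs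
  have hl0 : x l ≠ 0 := (Finset.mem_filter.1 hl).2
  have h1 : (R x) l = 0 := by
    rw [euclidean_eq_sum_single x, map_sum, WithLp.ofLp_sum, Finset.sum_apply]
    refine Finset.sum_eq_zero fun m _ => ?_
    by_cases hm : x m = 0
    · simp [hm]
    · have := hmax m (by simp [hm])
      simp [hR l m this]
  have h2 := congrArg (fun z : EuclideanSpace ℝ ι => z l) hx
  simp [h1, hl0] at h2

end Grading

/-! ### Decay of strictly lower triangular operators under the diagonal flow -/

section Diagonal

variable {ι : Type*} [Fintype ι] [DecidableEq ι]

/-- The operator that multiplies the coordinate `i` by `β i`. -/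
noncomputable def diagOp (β : ι → ℝ) : EuclideanSpace ℝ ι →L[ℝ] EuclideanSpace ℝ ι :=
  Matrix.toEuclideanCLM (n := ι) (𝕜 := ℝ) (Matrix.diagonal β)

theorem diagOp_apply (β : ι → ℝ) (x : EuclideanSpace ℝ ι) (i : ι) :
    diagOp β x i = β i * x i := by
  rw [diagOp, Matrix.ofLp_toEuclideanCLM, Matrix.mulVec_diagonal]

theorem exp_smul_diagOp_apply (β : ι → ℝ) (t : ℝ) (x : EuclideanSpace ℝ ι) (i : ι) :
    NormedSpace.exp (t • diagOp β) x i = Real.exp (t * β i) * x i := by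
  have hd : ∀ t : ℝ, HasDerivAt
      (fun t : ℝ => ∑ l, Real.exp (t * β l) • (x l • EuclideanSpace.single l (1 : ℝ)))
      (diagOp β (∑ l, Real.exp (t * β l) • (x l • EuclideanSpace.single l (1 : ℝ)))) t := by
    intro t
    have h1 : ∀ l, diagOp β (EuclideanSpace.single l (1 : ℝ)) =
        β l • EuclideanSpace.single l (1 : ℝ) := by
      intro l
      ext m
      rw [diagOp_apply]
      by_cases hm : m = l <;> simp [hm]
    simp only [map_sum, map_smul, h1]
    refine HasDerivAt.fun_sum fun l _ => ?_
    have h2 := (((hasDerivAt_id t).mul_const (β l)).exp).smul_const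
      (x l • EuclideanSpace.single l (1 : ℝ))
    refine h2.congr_deriv ?_
    simp only [smul_smul, id]
    congr 1
    ring
  have h := exp_smul_apply_eq_of_hasDerivAt (diagOp β) hd t
  simp only [zero_mul, Real.exp_zero, one_smul, ← euclidean_eq_sum_single] at h
  rw [h]
  simp [Finset.sum_apply, Pi.single_apply]

theorem tendsto_exp_diagOp_conj {β : ι → ℝ} {R : EuclideanSpace ℝ ι →L[ℝ] EuclideanSpace ℝ ι}
    (hR : ∀ i l, β l ≤ β i → R (EuclideanSpace.single l 1) i = 0) :
    Tendsto (fun t : ℝ => NormedSpace.exp (t • diagOp β) * R * NormedSpace.exp (-t • diagOp β))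
      atTop (𝓝 0) := by
  have h1 : ∀ t : ℝ, NormedSpace.exp (t • diagOp β) * R * NormedSpace.exp (-t • diagOp β) =
      ∑ i, ∑ l, (Real.exp (t * (β i - β l)) * R (EuclideanSpace.single l 1) i) •
        (innerSL ℝ (EuclideanSpace.single l (1 : ℝ))).smulRight
          (EuclideanSpace.single i (1 : ℝ)) := by
    intro t
    ext x m
    have h2 : ∀ y : EuclideanSpace ℝ ι, R y m = ∑ l, y l * R (EuclideanSpace.single l 1) m := by
      intro y
      conv_lhs => rw [euclidean_eq_sum_single y]
      rw [map_sum, WithLp.ofLp_sum, Finset.sum_apply]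
      simp
    rw [mul_apply_eq_comp, mul_apply_eq_comp, exp_smul_diagOp_apply, h2]
    simp only [exp_smul_diagOp_apply, Finset.mul_sum]
    simp only [_root_.sum_apply, WithLp.ofLp_sum, Finset.sum_apply, smul_apply,
      ContinuousLinearMap.smulRight_apply, PiLp.smul_apply, innerSL_apply_apply,
      EuclideanSpace.inner_single_left, PiLp.single_apply, smul_eq_mul]
    symm
    rw [Finset.sum_eq_single m]
    · refine Finset.sum_congr rfl fun l _ => ?_
      have : Real.exp (t * (β m - β l)) = Real.exp (t * β m) * Real.exp (-t * β l) := by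
        rw [← Real.exp_add]
        congr 1
        ring
      rw [this]
      simp
      ring
    · intro i _ hi
      simp [hi.symm]
    · simp
  simp only [h1]
  rw [show (0 : EuclideanSpace ℝ ι →L[ℝ] EuclideanSpace ℝ ι) = ∑ i : ι, ∑ l : ι, (0 : ℝ) •
        (innerSL ℝ (EuclideanSpace.single l (1 : ℝ))).smulRight
          (EuclideanSpace.single i (1 : ℝ)) by simp]
  refine tendsto_finsetSum _ fun i _ => tendsto_finsetSum _ fun l _ => ?_
  refine Tendsto.smul_const ?_ _
  rcases le_or_gt (β l) (β i) with h | h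
  · simp [hR i l h]
  · have h3 : Tendsto (fun t : ℝ => t * (β i - β l)) atTop atBot :=
      tendsto_id.atTop_mul_const_of_neg (sub_neg.2 h)
    simpa using (Real.tendsto_exp_atBot.comp h3).mul_const (R (EuclideanSpace.single l 1) i)

end Diagonal

/-! ### The block-diagonal operator -/

section Blocks

variable {k : ℕ} {n : Fin k → ℕ} {β ω ρ : Fin k → ℝ}

/-- The Euclidean space whose coordinates are the positions in the diagonal blocks. -/
abbrev BlockSpace (n : Fin k → ℕ) : Type := EuclideanSpace ℝ (Σ j, Fin (n j))

/-- The operator `diag(Λ_1, …, Λ_k)`. -/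
noncomputable def schurOp (n : Fin k → ℕ) (β ω ρ : Fin k → ℝ) : BlockSpace n →L[ℝ] BlockSpace n :=
  Matrix.toEuclideanCLM (n := Σ j, Fin (n j)) (𝕜 := ℝ)
    (Matrix.blockDiagonal' fun j => schurBlock (n j) (β j) (ω j) (ρ j))

/-- The weight of a coordinate: the real part of the eigenvalues of its block. -/
def weight (n : Fin k → ℕ) (β : Fin k → ℝ) : (Σ j, Fin (n j)) → ℝ := fun i => β i.1

/-- The properties of the block data that determine the rotation of subspaces: blocks have size
one or two, and the real part of a block of size two belongs to no other block. -/
structure IsSchurData (n : Fin k → ℕ) (β ω ρ : Fin k → ℝ) : Prop where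
  size : ∀ j, n j = 1 ∨ n j = 2
  omega_pos : ∀ j, n j = 2 → 0 < ω j
  rho_pos : ∀ j, n j = 2 → 0 < ρ j
  isolated : ∀ j, n j = 2 → ∀ ν, ν ≠ j → β j ≠ β ν

theorem schurOp_apply (n : Fin k → ℕ) (β ω ρ : Fin k → ℝ) (x : BlockSpace n) (j : Fin k)
    (a : Fin (n j)) :
    schurOp n β ω ρ x ⟨j, a⟩ =
      ∑ c, schurBlock (n j) (β j) (ω j) (ρ j) a c * x ⟨j, c⟩ := by
  rw [schurOp, Matrix.ofLp_toEuclideanCLM, Matrix.mulVec, dotProduct, Fintype.sum_sigma,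
    Finset.sum_eq_single j]
  · simp
  · intro l _ hl
    refine Finset.sum_eq_zero fun c _ => ?_
    rw [Matrix.blockDiagonal'_apply_ne _ _ _ hl.symm, zero_mul]
  · simp

theorem schurOp_eq_diagOp_add (n : Fin k → ℕ) (β ω ρ : Fin k → ℝ) :
    schurOp n β ω ρ = diagOp (weight n β) + schurOp n 0 ω ρ := by
  ext x ⟨j, a⟩
  rw [add_apply, PiLp.add_apply, schurOp_apply, schurOp_apply, diagOp_apply]
  have : ∀ c, schurBlock (n j) (β j) (ω j) (ρ j) a c =
      (if a = c then β j else 0) + schurBlock (n j) ((0 : Fin k → ℝ) j) (ω j) (ρ j) a c := by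
    intro c
    unfold schurBlock
    split_ifs <;> simp
  simp [this, add_mul, Finset.sum_add_distrib, weight]

theorem commute_diagOp_schurOp (n : Fin k → ℕ) (β γ ω ρ : Fin k → ℝ) :
    Commute (diagOp (weight n γ)) (schurOp n β ω ρ) := by
  ext x ⟨j, a⟩
  simp only [mul_apply_eq_comp, diagOp_apply, schurOp_apply, Finset.mul_sum, weight]
  exact Finset.sum_congr rfl fun c _ => by ring

theorem level_schurOp (n : Fin k → ℕ) (β γ ω ρ : Fin k → ℝ) (b : ℝ) (x : BlockSpace n) :
    level (weight n γ) b (schurOp n β ω ρ x) = schurOp n β ω ρ (level (weight n γ) b x) := by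
  ext ⟨j, a⟩
  simp only [level_apply, schurOp_apply, weight]
  by_cases hb : γ j = b
  · rw [if_pos hb]
    exact Finset.sum_congr rfl fun c _ =>
      congrArg (fun z : ℝ => schurBlock (n j) (β j) (ω j) (ρ j) a c * z) (if_pos hb).symm
  · rw [if_neg hb]
    exact (Finset.sum_eq_zero fun c _ =>
      (congrArg (fun z : ℝ => schurBlock (n j) (β j) (ω j) (ρ j) a c * z) (if_neg hb)).trans
        (mul_zero _)).symm

theorem level_exp_smul_schurOp (n : Fin k → ℕ) (β γ ω ρ : Fin k → ℝ) (b t : ℝ)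
    (x : BlockSpace n) :
    level (weight n γ) b (NormedSpace.exp (t • schurOp n β ω ρ) x) =
      NormedSpace.exp (t • schurOp n β ω ρ) (level (weight n γ) b x) := by
  have hc : Commute (LinearMap.toContinuousLinearMap (level (weight n γ) b))
      (schurOp n β ω ρ) := by
    ext1 x
    exact level_schurOp n β γ ω ρ b x
  exact apply_exp_smul_of_commute hc t x

theorem schurOp_apply_of_size_eq_one {j : Fin k} (hj : n j = 1) (β ω ρ : Fin k → ℝ)
    (x : BlockSpace n) (a : Fin (n j)) : schurOp n β ω ρ x ⟨j, a⟩ = β j * x ⟨j, a⟩ := by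
  have hs : ∀ c : Fin (n j), c = a := fun c => Fin.ext (by omega)
  rw [schurOp_apply, Finset.sum_eq_single a (fun c _ hc => absurd (hs c) hc) (by simp)]
  simp [schurBlock]

/-- The vector with coordinates `(a, b)` in the block `j` and zero elsewhere, for a block of size
two. -/
noncomputable def blockVec (n : Fin k → ℕ) (j : Fin k) (a b : ℝ) : BlockSpace n :=
  WithLp.toLp 2 fun i => if i.1 = j then if (i.2 : ℕ) = 0 then a else b else 0

theorem blockVec_apply (n : Fin k → ℕ) (j : Fin k) (a b : ℝ) (i : Σ j, Fin (n j)) :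
    blockVec n j a b i = if i.1 = j then if (i.2 : ℕ) = 0 then a else b else 0 := rfl

theorem blockVec_add (n : Fin k → ℕ) (j : Fin k) (a b a' b' : ℝ) :
    blockVec n j a b + blockVec n j a' b' = blockVec n j (a + a') (b + b') := by
  ext i
  simp only [PiLp.add_apply, blockVec_apply]
  split_ifs <;> simp

theorem smul_blockVec (n : Fin k → ℕ) (j : Fin k) (c a b : ℝ) :
    c • blockVec n j a b = blockVec n j (c * a) (c * b) := by
  ext i
  simp only [PiLp.smul_apply, blockVec_apply]
  split_ifs <;> simp

theorem blockVec_zero (n : Fin k → ℕ) (j : Fin k) : blockVec n j 0 0 = 0 := by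
  ext i
  simp [blockVec_apply]

theorem sum_fin_of_eq_two {m : ℕ} (hm : m = 2) (f : Fin m → ℝ) :
    ∑ c, f c = f ⟨0, by omega⟩ + f ⟨1, by omega⟩ := by
  subst hm
  exact Fin.sum_univ_two f

theorem schurBlock_apply_of_eq_two {m : ℕ} (hm : m = 2) (β ω ρ : ℝ) (a : Fin m) :
    schurBlock m β ω ρ a ⟨0, by omega⟩ = (if (a : ℕ) = 0 then β else ρ * ω) ∧
      schurBlock m β ω ρ a ⟨1, by omega⟩ = if (a : ℕ) = 0 then -(ω / ρ) else β := by
  subst hm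
  fin_cases a <;> simp [schurBlock]

theorem schurOp_blockVec {j : Fin k} (hj : n j = 2) (β ω ρ : Fin k → ℝ) (a b : ℝ) :
    schurOp n β ω ρ (blockVec n j a b) =
      blockVec n j (β j * a - ω j / ρ j * b) (ρ j * ω j * a + β j * b) := by
  ext ⟨l, c⟩
  rw [schurOp_apply, blockVec_apply]
  by_cases hl : l = j
  · subst hl
    obtain ⟨h0, h1⟩ := schurBlock_apply_of_eq_two hj (β l) (ω l) (ρ l) c
    rw [sum_fin_of_eq_two hj, h0, h1]
    simp only [blockVec_apply]
    by_cases hc : (c : ℕ) = 0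
    · simp [hc]; ring
    · simp [hc]
  · simp [blockVec_apply, hl]

theorem inner_blockVec {j : Fin k} (hj : n j = 2) (a b : ℝ) (x : BlockSpace n) :
    inner ℝ (blockVec n j a b) x = a * x ⟨j, ⟨0, by omega⟩⟩ + b * x ⟨j, ⟨1, by omega⟩⟩ := by
  rw [PiLp.inner_apply, Fintype.sum_sigma, Finset.sum_eq_single j]
  · rw [sum_fin_of_eq_two hj]
    simp [blockVec_apply]
    ring
  · intro l _ hl
    simp [blockVec_apply, hl]
  · simp

theorem inner_blockVec_blockVec {j : Fin k} (hj : n j = 2) (a b c d : ℝ) :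
    inner ℝ (blockVec n j a b) (blockVec n j c d) = a * c + b * d := by
  rw [inner_blockVec hj]
  simp [blockVec_apply]

theorem inner_blockVec_blockVec_of_ne {j l : Fin k} (hj : n j = 2) (hl : j ≠ l) (a b c d : ℝ) :
    inner ℝ (blockVec n j a b) (blockVec n l c d) = 0 := by
  rw [inner_blockVec hj]
  simp [blockVec_apply, hl]

/-- The point of phase `φ` on the ellipse with half-axes `1` and `ρ j` in the block `j`, which is
invariant under the flow up to scaling. -/
noncomputable def ellipseVec (n : Fin k → ℕ) (ρ : Fin k → ℝ) (j : Fin k) (φ : ℝ) : BlockSpace n :=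
  blockVec n j (Real.cos φ) (ρ j * Real.sin φ)

theorem exp_smul_schurOp_ellipseVec {j : Fin k} (hj : n j = 2) (hρ : ρ j ≠ 0) (β ω : Fin k → ℝ)
    (φ t : ℝ) :
    NormedSpace.exp (t • schurOp n β ω ρ) (ellipseVec n ρ j φ) =
      Real.exp (t * β j) • ellipseVec n ρ j (φ + ω j * t) := by
  have hsplit : ∀ a b : ℝ, blockVec n j a b = a • blockVec n j 1 0 + b • blockVec n j 0 1 := by
    intro a b
    simp [smul_blockVec, blockVec_add]
  have hd : ∀ t : ℝ, HasDerivAt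
      (fun t : ℝ => Real.exp (t * β j) • ellipseVec n ρ j (φ + ω j * t))
      (schurOp n β ω ρ (Real.exp (t * β j) • ellipseVec n ρ j (φ + ω j * t))) t := by
    intro t
    have he : HasDerivAt (fun t : ℝ => Real.exp (t * β j)) (Real.exp (t * β j) * β j) t := by
      simpa using ((hasDerivAt_id t).mul_const (β j)).exp
    have hlin : HasDerivAt (fun t : ℝ => φ + ω j * t) (ω j) t := by
      simpa using ((hasDerivAt_id t).const_mul (ω j)).const_add φ
    have hv : HasDerivAt (fun t : ℝ => ellipseVec n ρ j (φ + ω j * t))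
        (blockVec n j (-Real.sin (φ + ω j * t) * ω j)
          (ρ j * (Real.cos (φ + ω j * t) * ω j))) t := by
      have h1 := (hlin.cos.smul_const (blockVec n j 1 0)).add
        ((hlin.sin.const_mul (ρ j)).smul_const (blockVec n j 0 1))
      rw [hsplit]
      refine h1.congr_of_eventuallyEq (Eventually.of_forall fun s => ?_)
      simp [ellipseVec, ← hsplit]
    refine (he.smul hv).congr_deriv ?_
    rw [map_smul, ellipseVec, schurOp_blockVec hj, smul_blockVec, smul_blockVec, smul_blockVec,
      blockVec_add]
    congr 1
    · field_simp
      ring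
    · ring
  simpa using exp_smul_apply_eq_of_hasDerivAt (schurOp n β ω ρ) hd t

theorem single_eq_blockVec {j : Fin k} (hj : n j = 2) (a : Fin (n j)) :
    (EuclideanSpace.single ⟨j, a⟩ 1 : BlockSpace n) =
      if (a : ℕ) = 0 then blockVec n j 1 0 else blockVec n j 0 1 := by
  ext ⟨l, c⟩
  rw [PiLp.single_apply]
  by_cases hl : l = j
  · subst hl
    have hca : (⟨l, c⟩ : Σ j, Fin (n j)) = ⟨l, a⟩ ↔ (c : ℕ) = a := by
      simp [Fin.ext_iff]
    simp only [hca]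
    have h1 := c.2
    have h2 := a.2
    rcases (show (a : ℕ) = 0 ∨ (a : ℕ) = 1 by omega) with h | h <;>
    rcases (show (c : ℕ) = 0 ∨ (c : ℕ) = 1 by omega) with h' | h' <;>
    simp [h, h', blockVec_apply]
  · have : (⟨l, c⟩ : Σ j, Fin (n j)) ≠ ⟨j, a⟩ := fun h => hl (congrArg Sigma.fst h)
    rw [if_neg this]
    split_ifs <;> simp [blockVec_apply, hl]

/-- Without the real parts, the flow is a product of elliptic rotations, hence bounded. -/
theorem exists_norm_exp_smul_schurOp_zero_le (h : IsSchurData n β ω ρ) :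
    ∃ C, 0 ≤ C ∧ ∀ t : ℝ, ‖NormedSpace.exp (t • schurOp n 0 ω ρ)‖ ≤ C := by
  have hbv : ∀ j a b, ‖blockVec n j a b‖ ≤
      |a| * ‖blockVec n j 1 0‖ + |b| * ‖blockVec n j 0 1‖ := by
    intro j a b
    have : blockVec n j a b = a • blockVec n j 1 0 + b • blockVec n j 0 1 := by
      simp [smul_blockVec, blockVec_add]
    rw [this]
    refine (norm_add_le _ _).trans ?_
    rw [norm_smul, norm_smul, Real.norm_eq_abs, Real.norm_eq_abs]
  have hell : ∀ j φ, ‖ellipseVec n ρ j φ‖ ≤ ‖blockVec n j 1 0‖ + |ρ j| * ‖blockVec n j 0 1‖ := by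
    intro j φ
    refine (hbv _ _ _).trans ?_
    rw [abs_mul]
    have h1 := Real.abs_cos_le_one φ
    have h2 := Real.abs_sin_le_one φ
    gcongr
    · exact mul_le_of_le_one_left (norm_nonneg _) h1
    · exact mul_le_of_le_one_right (abs_nonneg _) h2
  have hi : ∀ i, ∃ c, ∀ t : ℝ,
      ‖NormedSpace.exp (t • schurOp n 0 ω ρ) (EuclideanSpace.single i 1)‖ ≤ c := by
    rintro ⟨j, a⟩
    rcases h.size j with hj | hj
    · refine ⟨‖(EuclideanSpace.single ⟨j, a⟩ 1 : BlockSpace n)‖, fun t => ?_⟩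
      have h0 : schurOp n 0 ω ρ (EuclideanSpace.single ⟨j, a⟩ 1) = 0 := by
        ext ⟨l, c⟩
        by_cases hl : l = j
        · subst hl
          rw [schurOp_apply_of_size_eq_one hj]
          simp
        · rw [schurOp_apply]
          refine Finset.sum_eq_zero fun e _ => ?_
          have : (⟨l, e⟩ : Σ j, Fin (n j)) ≠ ⟨j, a⟩ := fun h => hl (congrArg Sigma.fst h)
          rw [PiLp.single_apply, if_neg this, mul_zero]
      have h1 := exp_smul_apply_eq_of_hasDerivAt (schurOp n 0 ω ρ)
        (u := fun _ => EuclideanSpace.single ⟨j, a⟩ 1)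
        (fun t => by rw [h0]; exact hasDerivAt_const _ _) t
      rw [h1]
    · have hρ := (h.rho_pos j hj).ne'
      rw [single_eq_blockVec hj a]
      split_ifs
      · refine ⟨‖blockVec n j 1 0‖ + |ρ j| * ‖blockVec n j 0 1‖, fun t => ?_⟩
        have h1 : blockVec n j 1 0 = ellipseVec n ρ j 0 := by simp [ellipseVec]
        have h2 := hell j (0 + ω j * t)
        conv_lhs => rw [h1]
        rw [exp_smul_schurOp_ellipseVec hj hρ]
        simpa using h2
      · refine ⟨|(ρ j)⁻¹| * (‖blockVec n j 1 0‖ + |ρ j| * ‖blockVec n j 0 1‖), fun t => ?_⟩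
        have h1 : blockVec n j 0 1 = (ρ j)⁻¹ • ellipseVec n ρ j (Real.pi / 2) := by
          simp [ellipseVec, smul_blockVec, hρ]
        have h2 := hell j (Real.pi / 2 + ω j * t)
        conv_lhs => rw [h1]
        rw [map_smul, exp_smul_schurOp_ellipseVec hj hρ, norm_smul, Real.norm_eq_abs]
        gcongr
        simpa using h2
  choose c hc using hi
  have hc0 : ∀ i, 0 ≤ c i := fun i => (norm_nonneg _).trans (hc i 0)
  refine ⟨∑ i, c i, Finset.sum_nonneg fun i _ => hc0 i, fun t => ?_⟩
  refine ContinuousLinearMap.opNorm_le_bound _ (Finset.sum_nonneg fun i _ => hc0 i) fun x => ?_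
  conv_lhs => rw [euclidean_eq_sum_single x]
  rw [map_sum, Finset.sum_mul]
  refine (norm_sum_le _ _).trans (Finset.sum_le_sum fun i _ => ?_)
  rw [map_smul, norm_smul, mul_comm]
  exact mul_le_mul (hc i t) (PiLp.norm_apply_le x i) (norm_nonneg _) (hc0 i)

/-- An operator that strictly lowers the real parts decays when transported by the flow. -/
theorem tendsto_exp_schurOp_conj (h : IsSchurData n β ω ρ) {R : BlockSpace n →L[ℝ] BlockSpace n}
    (hR : ∀ i l, weight n β l ≤ weight n β i → R (EuclideanSpace.single l 1) i = 0) :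
    Tendsto (fun t : ℝ => NormedSpace.exp (t • schurOp n β ω ρ) * R *
      NormedSpace.exp (-t • schurOp n β ω ρ)) atTop (𝓝 0) := by
  obtain ⟨C, hC0, hC⟩ := exists_norm_exp_smul_schurOp_zero_le h
  set D := diagOp (weight n β) with hD
  set N := schurOp n 0 ω ρ with hN
  have hDN : Commute D N := commute_diagOp_schurOp n 0 β ω ρ
  have hexp : ∀ t : ℝ, NormedSpace.exp (t • schurOp n β ω ρ) =
      NormedSpace.exp (t • D) * NormedSpace.exp (t • N) ∧
      NormedSpace.exp (t • schurOp n β ω ρ) =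
      NormedSpace.exp (t • N) * NormedSpace.exp (t • D) := by
    intro t
    constructor
    · rw [schurOp_eq_diagOp_add, exp_smul_add_of_commute hDN]
    · rw [schurOp_eq_diagOp_add, add_comm, exp_smul_add_of_commute hDN.symm]
  have hlim := tendsto_exp_diagOp_conj hR
  have hlim' : Tendsto (fun t : ℝ => C * ‖NormedSpace.exp (t • D) * R *
      NormedSpace.exp (-t • D)‖ * C) atTop (𝓝 0) := by
    simpa using (hlim.norm.const_mul C).mul_const C
  refine squeeze_zero_norm (fun t => ?_) hlim'
  rw [(hexp t).2, (hexp (-t)).1]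
  calc ‖NormedSpace.exp (t • N) * NormedSpace.exp (t • D) * R *
        (NormedSpace.exp (-t • D) * NormedSpace.exp (-t • N))‖
      = ‖NormedSpace.exp (t • N) * (NormedSpace.exp (t • D) * R * NormedSpace.exp (-t • D)) *
        NormedSpace.exp (-t • N)‖ := by simp only [mul_assoc]
    _ ≤ ‖NormedSpace.exp (t • N)‖ * ‖NormedSpace.exp (t • D) * R * NormedSpace.exp (-t • D)‖ *
        ‖NormedSpace.exp (-t • N)‖ := norm_mul₃_le
    _ ≤ C * ‖NormedSpace.exp (t • D) * R * NormedSpace.exp (-t • D)‖ * C := by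
        gcongr
        · exact hC t
        · exact hC (-t)

end Blocks

/-! ### Profiles of graded subspaces and their rotation speed -/

section Profile

variable {k : ℕ} {n : Fin k → ℕ} {β ω ρ : Fin k → ℝ}

theorem level_eq_blockVec (h : IsSchurData n β ω ρ) {j : Fin k} (hj : n j = 2)
    (x : BlockSpace n) :
    level (weight n β) (β j) x =
      blockVec n j (x ⟨j, ⟨0, by omega⟩⟩) (x ⟨j, ⟨1, by omega⟩⟩) := by
  ext ⟨l, c⟩
  rw [level_apply, blockVec_apply]
  by_cases hl : l = j
  · subst hl
    simp only [weight, if_true]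
    split_ifs with hc
    · rw [show c = ⟨0, by omega⟩ from Fin.ext hc]
    · have h1 : (c : ℕ) = 1 := by have := c.2; omega
      rw [show c = ⟨1, by omega⟩ from Fin.ext h1]
  · have : β l ≠ β j := (h.isolated j hj l hl).symm
    simp [weight, hl, this]

theorem level_blockVec (β : Fin k → ℝ) (b : ℝ) (j : Fin k) (x y : ℝ) :
    level (weight n β) b (blockVec n j x y) = if β j = b then blockVec n j x y else 0 := by
  ext ⟨l, c⟩
  by_cases hl : l = j
  · subst hl
    by_cases hb : β l = b <;> simp [weight, hb]
  · by_cases hb : β j = b <;> simp [hb, blockVec_apply, hl]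

/-- The unit vector in the direction of the point of phase `φ` on the invariant ellipse. -/
noncomputable def ellipseUnit (n : Fin k → ℕ) (ρ : Fin k → ℝ) (j : Fin k) (φ : ℝ) :
    BlockSpace n :=
  (√(Real.cos φ ^ 2 + ρ j ^ 2 * Real.sin φ ^ 2))⁻¹ • ellipseVec n ρ j φ

/-- The unit vector of the block `j` orthogonal to `ellipseUnit n ρ j φ`. -/
noncomputable def ellipseNormal (n : Fin k → ℕ) (ρ : Fin k → ℝ) (j : Fin k) (φ : ℝ) :
    BlockSpace n :=
  (√(Real.cos φ ^ 2 + ρ j ^ 2 * Real.sin φ ^ 2))⁻¹ •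
    blockVec n j (-(ρ j * Real.sin φ)) (Real.cos φ)

theorem cos_sq_add_mul_sin_sq_pos {r : ℝ} (hr : r ≠ 0) (φ : ℝ) :
    0 < Real.cos φ ^ 2 + r ^ 2 * Real.sin φ ^ 2 := by
  have h := Real.sin_sq_add_cos_sq φ
  rcases eq_or_ne (Real.sin φ) 0 with hs | hs
  · rw [hs] at h ⊢
    nlinarith
  · have : 0 < r ^ 2 * Real.sin φ ^ 2 := by positivity
    nlinarith [sq_nonneg (Real.cos φ)]

theorem ellipseSpeed_nonneg {r w : ℝ} (hr : 0 < r) (hw : 0 < w) (φ : ℝ) :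
    0 ≤ ellipseSpeed r w φ :=
  div_nonneg (mul_pos hr hw).le (cos_sq_add_mul_sin_sq_pos hr.ne' φ).le

theorem inv_sqrt_mul_inv_sqrt_mul {q : ℝ} (hq : 0 < q) : (√q)⁻¹ * ((√q)⁻¹ * q) = 1 := by
  have h := Real.mul_self_sqrt hq.le
  have h0 : √q ≠ 0 := (Real.sqrt_pos.2 hq).ne'
  field_simp
  rw [sq, h]

theorem orthonormal_ellipseUnit {J : Finset (Fin k)} (hJ : ∀ j ∈ J, n j = 2)
    (hρ : ∀ j ∈ J, ρ j ≠ 0) (φ : Fin k → ℝ) :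
    Orthonormal ℝ fun j : J => ellipseUnit n ρ j (φ j) := by
  rw [orthonormal_iff_ite]
  intro i j
  rw [ellipseUnit, ellipseUnit, inner_smul_left, inner_smul_right, ellipseVec, ellipseVec]
  split_ifs with hij
  · subst hij
    rw [inner_blockVec_blockVec (hJ _ i.2), conj_trivial]
    linear_combination
      inv_sqrt_mul_inv_sqrt_mul (cos_sq_add_mul_sin_sq_pos (hρ _ i.2) (φ i))
  · have : (i : Fin k) ≠ j := fun h => hij (Subtype.ext h)
    simp [inner_blockVec_blockVec_of_ne (hJ _ i.2) this]

theorem orthonormal_ellipseNormal {J : Finset (Fin k)} (hJ : ∀ j ∈ J, n j = 2)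
    (hρ : ∀ j ∈ J, ρ j ≠ 0) (φ : Fin k → ℝ) :
    Orthonormal ℝ fun j : J => ellipseNormal n ρ j (φ j) := by
  rw [orthonormal_iff_ite]
  intro i j
  rw [ellipseNormal, ellipseNormal, inner_smul_left, inner_smul_right]
  split_ifs with hij
  · subst hij
    rw [inner_blockVec_blockVec (hJ _ i.2), conj_trivial]
    linear_combination
      inv_sqrt_mul_inv_sqrt_mul (cos_sq_add_mul_sin_sq_pos (hρ _ i.2) (φ i))
  · have : (i : Fin k) ≠ j := fun h => hij (Subtype.ext h)
    simp [inner_blockVec_blockVec_of_ne (hJ _ i.2) this]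

theorem inner_ellipseNormal_ellipseVec {j : Fin k} (hj : n j = 2) (ρ : Fin k → ℝ) (φ : ℝ) :
    inner ℝ (ellipseNormal n ρ j φ) (ellipseVec n ρ j φ) = 0 := by
  rw [ellipseNormal, ellipseVec, inner_smul_left, inner_blockVec_blockVec hj]
  ring

theorem level_ellipseNormal (β ρ : Fin k → ℝ) (j : Fin k) (φ : ℝ) :
    level (weight n β) (β j) (ellipseNormal n ρ j φ) = ellipseNormal n ρ j φ := by
  rw [ellipseNormal, map_smul, level_blockVec, if_pos rfl]

/-- The component of `A u` normal to a unit vector `u` of phase `φ` is `ellipseSpeed ρ ω φ`. -/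
theorem exists_schurOp_ellipseUnit_eq {j : Fin k} (hj : n j = 2) (hρ : ρ j ≠ 0)
    (β ω : Fin k → ℝ) (φ : ℝ) :
    ∃ c : ℝ, schurOp n β ω ρ (ellipseUnit n ρ j φ) =
      c • ellipseUnit n ρ j φ + ellipseSpeed (ρ j) (ω j) φ • ellipseNormal n ρ j φ := by
  set q := Real.cos φ ^ 2 + ρ j ^ 2 * Real.sin φ ^ 2 with hq
  have hq0 : q ≠ 0 := (cos_sq_add_mul_sin_sq_pos hρ φ).ne'
  have hsc := Real.sin_sq_add_cos_sq φ
  refine ⟨β j + ω j * (ρ j ^ 2 - 1) * Real.sin φ * Real.cos φ / q, ?_⟩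
  rw [ellipseUnit, ellipseNormal, ← hq, map_smul, smul_comm _ (√q)⁻¹, smul_comm _ (√q)⁻¹,
    ← smul_add, ellipseVec, schurOp_blockVec hj]
  congr 1
  rw [smul_blockVec, smul_blockVec, blockVec_add, ellipseSpeed, ← hq]
  congr 1
  · field_simp
    rw [hq]
    linear_combination (-(Real.sin φ * ω j * ρ j ^ 2)) * hsc
  · field_simp
    rw [hq]
    linear_combination (Real.cos φ * ω j) * hsc

/-- The profile of a graded subspace `W`: it meets the complex blocks `j ∈ J` in the line of phase
`φ j`, and every other complex block either trivially or completely. The position of `W` in the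
real levels does not matter, since the flow only scales them. -/
structure HasProfile (n : Fin k → ℕ) (β ρ : Fin k → ℝ) (W : Submodule ℝ (BlockSpace n))
    (J : Finset (Fin k)) (φ : Fin k → ℝ) : Prop where
  graded : IsGraded (weight n β) W
  size_eq_two : ∀ j ∈ J, n j = 2
  line : ∀ j ∈ J, W.map (level (weight n β) (β j)) = Submodule.span ℝ {ellipseVec n ρ j (φ j)}
  rest : ∀ j, n j = 2 → j ∉ J → W.map (level (weight n β) (β j)) = ⊥ ∨
    W.map (level (weight n β) (β j)) = LinearMap.range (level (weight n β) (β j))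

theorem map_level_eq_bot_or_range_or_span (h : IsSchurData n β ω ρ) {j : Fin k} (hj : n j = 2)
    (W : Submodule ℝ (BlockSpace n)) :
    W.map (level (weight n β) (β j)) = ⊥ ∨
    W.map (level (weight n β) (β j)) = LinearMap.range (level (weight n β) (β j)) ∨
    ∃ φ, W.map (level (weight n β) (β j)) = Submodule.span ℝ {ellipseVec n ρ j φ} := by
  set U := W.map (level (weight n β) (β j)) with hU
  have hUv : ∀ y ∈ U, ∃ c d, y = blockVec n j c d := by
    rintro _ ⟨x, _, rfl⟩
    exact ⟨_, _, level_eq_blockVec h hj x⟩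
  have hρ : ρ j ≠ 0 := (h.rho_pos j hj).ne'
  by_cases h0 : U = ⊥
  · exact Or.inl h0
  obtain ⟨x, hxU, hx0⟩ := Submodule.exists_mem_ne_zero_of_ne_bot h0
  obtain ⟨a, b, rfl⟩ := hUv x hxU
  -- elliptic polar coordinates of `(a, b)`
  set z : ℂ := ⟨a, b / ρ j⟩ with hz
  have hza : ‖z‖ * Real.cos z.arg = a := Complex.norm_mul_cos_arg z
  have hzb : ρ j * (‖z‖ * Real.sin z.arg) = b := by
    rw [Complex.norm_mul_sin_arg z, hz]
    field_simp
  have hz0 : ‖z‖ ≠ 0 := by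
    intro hz0
    rw [hz0] at hza hzb
    refine hx0 ?_
    rw [← hza, ← hzb]
    simp [blockVec_zero]
  have hvec : ‖z‖ • ellipseVec n ρ j z.arg = blockVec n j a b := by
    rw [ellipseVec, smul_blockVec, hza, ← hzb]
    congr 1
    ring
  by_cases hall : ∀ y ∈ U, ∃ c : ℝ, y = c • blockVec n j a b
  · refine Or.inr (Or.inr ⟨z.arg, le_antisymm ?_ ?_⟩)
    · intro y hy
      obtain ⟨c, rfl⟩ := hall y hy
      rw [← hvec]
      exact Submodule.smul_mem _ _ (Submodule.smul_mem _ _ (Submodule.mem_span_singleton_self _))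
    · rw [Submodule.span_singleton_le_iff_mem, ← inv_smul_smul₀ hz0 (ellipseVec n ρ j z.arg), hvec]
      exact U.smul_mem _ hxU
  · push Not at hall
    obtain ⟨y, hyU, hy⟩ := hall
    obtain ⟨c, d, rfl⟩ := hUv y hyU
    have hdet : a * d - b * c ≠ 0 := by
      intro hdet
      by_cases ha : a = 0
      · have hb : b ≠ 0 := fun hb => hx0 (by rw [ha, hb, blockVec_zero])
        have hc : c = 0 := by
          rw [ha, zero_mul, zero_sub, neg_eq_zero] at hdet
          exact (mul_eq_zero.1 hdet).resolve_left hb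
        refine hy (d / b) ?_
        rw [smul_blockVec, ha, hc]
        field_simp
        simp
      · refine hy (c / a) ?_
        rw [smul_blockVec]
        congr 1
        · field_simp
        · field_simp
          linarith
    refine Or.inr (Or.inl (le_antisymm ?_ ?_))
    · rintro _ ⟨x, _, rfl⟩
      exact LinearMap.mem_range_self _ _
    · -- Cramer's rule
      rintro _ ⟨x, rfl⟩
      rw [level_eq_blockVec h hj]
      set p := x ⟨j, ⟨0, by omega⟩⟩
      set q := x ⟨j, ⟨1, by omega⟩⟩
      have hpq : blockVec n j p q = ((p * d - q * c) / (a * d - b * c)) • blockVec n j a b +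
          ((a * q - b * p) / (a * d - b * c)) • blockVec n j c d := by
        rw [smul_blockVec, smul_blockVec, blockVec_add]
        congr 1
        · rw [div_mul_eq_mul_div, div_mul_eq_mul_div, ← add_div, eq_div_iff hdet]
          ring
        · rw [div_mul_eq_mul_div, div_mul_eq_mul_div, ← add_div, eq_div_iff hdet]
          ring
      rw [hpq]
      exact add_mem (U.smul_mem _ hxU) (U.smul_mem _ hyU)

theorem exists_hasProfile (h : IsSchurData n β ω ρ) {W : Submodule ℝ (BlockSpace n)}
    (hW : IsGraded (weight n β) W) : ∃ J φ, HasProfile n β ρ W J φ := by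
  classical
  have hex : ∀ j, ∃ φ, n j = 2 → W.map (level (weight n β) (β j)) ≠ ⊥ →
      W.map (level (weight n β) (β j)) ≠ LinearMap.range (level (weight n β) (β j)) →
      W.map (level (weight n β) (β j)) = Submodule.span ℝ {ellipseVec n ρ j φ} := by
    intro j
    by_cases hj : n j = 2
    · rcases map_level_eq_bot_or_range_or_span h hj W with h1 | h1 | ⟨φ, h1⟩
      · exact ⟨0, fun _ h2 => absurd h1 h2⟩
      · exact ⟨0, fun _ _ h2 => absurd h1 h2⟩
      · exact ⟨φ, fun _ _ _ => h1⟩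
    · exact ⟨0, fun h2 => absurd h2 hj⟩
  choose φ hφ using hex
  refine ⟨Finset.univ.filter fun j => n j = 2 ∧ W.map (level (weight n β) (β j)) ≠ ⊥ ∧
      W.map (level (weight n β) (β j)) ≠ LinearMap.range (level (weight n β) (β j)), φ,
    hW, fun j hj => ?_, fun j hj => ?_, fun j h2 hj => ?_⟩
  · exact (Finset.mem_filter.1 hj).2.1
  · obtain ⟨h2, h3, h4⟩ := (Finset.mem_filter.1 hj).2
    exact hφ j h2 h3 h4
  · simp only [Finset.mem_filter, Finset.mem_univ, true_and, not_and_or, not_not] at hj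
    exact hj.resolve_left (fun h => h h2)

theorem HasProfile.evolve (h : IsSchurData n β ω ρ) {W : Submodule ℝ (BlockSpace n)}
    {J : Finset (Fin k)} {φ : Fin k → ℝ} (hW : HasProfile n β ρ W J φ) (t : ℝ) :
    HasProfile n β ρ (evolve (schurOp n β ω ρ) W t) J (fun j => φ j + ω j * t) := by
  have hmap : ∀ b, (AngularValue.evolve (schurOp n β ω ρ) W t).map (level (weight n β) b) =
      AngularValue.evolve (schurOp n β ω ρ) (W.map (level (weight n β) b)) t := by
    intro b
    rw [AngularValue.evolve, AngularValue.evolve, ← Submodule.map_comp, ← Submodule.map_comp]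
    congr 1
    ext1 x
    exact level_exp_smul_schurOp n β β ω ρ b t x
  refine ⟨?_, hW.size_eq_two, fun j hj => ?_, fun j h2 hj => ?_⟩
  · rintro b _ ⟨x, hx, rfl⟩
    refine ⟨level (weight n β) b x, hW.graded b x hx, ?_⟩
    exact (level_exp_smul_schurOp n β β ω ρ b t x).symm
  · have h2 := hW.size_eq_two j hj
    rw [hmap, hW.line j hj, AngularValue.evolve, Submodule.map_span, Set.image_singleton]
    have h3 := exp_smul_schurOp_ellipseVec h2 (h.rho_pos j h2).ne' β ω (φ j) t
    rw [ContinuousLinearMap.coe_coe, h3]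
    exact Submodule.span_singleton_smul_eq (IsUnit.mk0 _ (Real.exp_pos _).ne') _
  · rw [hmap]
    refine (hW.rest j h2 hj).imp (fun h3 => ?_) fun h3 => ?_
    · rw [h3, AngularValue.evolve, Submodule.map_bot]
    · rw [h3]
      refine le_antisymm ?_ ?_
      · rintro _ ⟨_, ⟨x, rfl⟩, rfl⟩
        exact ⟨_, level_exp_smul_schurOp n β β ω ρ (β j) t x⟩
      · rintro _ ⟨x, rfl⟩
        refine ⟨_, ⟨NormedSpace.exp (-t • schurOp n β ω ρ) x, rfl⟩, ?_⟩
        rw [ContinuousLinearMap.coe_coe, level_exp_smul_schurOp, exp_smul_apply_exp_neg_smul]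

theorem HasProfile.inner_ellipseNormal {W : Submodule ℝ (BlockSpace n)}
    {J : Finset (Fin k)} {φ : Fin k → ℝ} (hW : HasProfile n β ρ W J φ) {j : Fin k} (hj : j ∈ J)
    {x : BlockSpace n} (hx : x ∈ W) : inner ℝ (ellipseNormal n ρ j (φ j)) x = 0 := by
  rw [← level_ellipseNormal β, inner_level_left]
  have h1 : level (weight n β) (β j) x ∈ W.map (level (weight n β) (β j)) := ⟨x, hx, rfl⟩
  rw [hW.line j hj] at h1
  obtain ⟨c, hc⟩ := Submodule.mem_span_singleton.1 h1
  rw [← hc, inner_smul_right, inner_ellipseNormal_ellipseVec (hW.size_eq_two j hj), mul_zero]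

theorem HasProfile.ellipseUnit_mem {W : Submodule ℝ (BlockSpace n)}
    {J : Finset (Fin k)} {φ : Fin k → ℝ} (hW : HasProfile n β ρ W J φ) {j : Fin k} (hj : j ∈ J) :
    ellipseUnit n ρ j (φ j) ∈ W := by
  refine W.smul_mem _ ?_
  have h1 : ellipseVec n ρ j (φ j) ∈ W.map (level (weight n β) (β j)) := by
    rw [hW.line j hj]
    exact Submodule.mem_span_singleton_self _
  obtain ⟨x, hx, hxe⟩ := h1
  rw [← hxe]
  exact hW.graded _ _ hx

theorem IsGraded.starProjection_level {ι : Type*} [Fintype ι] {γ : ι → ℝ}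
    {W : Submodule ℝ (EuclideanSpace ℝ ι)} (hW : IsGraded γ W) (b : ℝ)
    (x : EuclideanSpace ℝ ι) :
    W.starProjection (level γ b x) = level γ b (W.starProjection x) := by
  refine (Submodule.eq_starProjection_of_mem_of_inner_eq_zero
    (hW b _ (W.starProjection_apply_mem x)) fun w hw => ?_)
  rw [← map_sub, inner_level_left]
  exact Submodule.starProjection_inner_eq_zero _ _ (hW b w hw)

/-- The rotation speed of a graded subspace is the largest of the speeds of its lines: on the real
levels the operator is scalar, and `(I - P) A P` is the sum of the rank-one operators that map the
unit vector of each line to its normal. -/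
theorem HasProfile.speed_eq (h : IsSchurData n β ω ρ) {W : Submodule ℝ (BlockSpace n)}
    {J : Finset (Fin k)} {φ : Fin k → ℝ} (hW : HasProfile n β ρ W J φ) :
    speed (schurOp n β ω ρ) W = ⨆ j : J, ellipseSpeed (ρ j) (ω j) (φ j) := by
  set A := schurOp n β ω ρ with hA
  set P := W.starProjection with hP
  have hρ : ∀ j ∈ J, ρ j ≠ 0 := fun j hj => (h.rho_pos j (hW.size_eq_two j hj)).ne'
  set u : J → BlockSpace n := fun j => ellipseUnit n ρ j (φ j) with hu
  set w : J → BlockSpace n := fun j => ellipseNormal n ρ j (φ j) with hw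
  have hou : Orthonormal ℝ u := orthonormal_ellipseUnit hW.size_eq_two hρ φ
  have how : Orthonormal ℝ w := orthonormal_ellipseNormal hW.size_eq_two hρ φ
  have hPmem : ∀ x ∈ W, P x = x := fun x hx => Submodule.starProjection_eq_self_iff.2 hx
  have hPw : ∀ j : J, P (w j) = 0 := fun j =>
    (Submodule.starProjection_apply_eq_zero_iff _).2 ((Submodule.mem_orthogonal' _ _).2
      fun x hx => hW.inner_ellipseNormal j.2 hx)
  have hlev : ∀ j : J, level (weight n β) (β j) (u j) = u j := fun j => by
    rw [hu]
    dsimp only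
    rw [ellipseUnit, map_smul, ellipseVec, level_blockVec, if_pos rfl]
  refine norm_sum_smulRight_eq_iSup hou how (fun j => ellipseSpeed_nonneg
    (h.rho_pos j (hW.size_eq_two j j.2)) (h.omega_pos j (hW.size_eq_two j j.2)) _) _ fun x => ?_
  -- it suffices to compare the two operators on coordinate vectors
  set T : BlockSpace n →ₗ[ℝ] BlockSpace n := ∑ j : J, (ellipseSpeed (ρ j) (ω j) (φ j)) •
    ((innerSL ℝ (u j)).smulRight (w j) : BlockSpace n →ₗ[ℝ] BlockSpace n) with hT
  have hTx : ∀ x, T x =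
      ∑ j : J, (ellipseSpeed (ρ j) (ω j) (φ j) * inner ℝ (u j) x) • w j := by
    intro x
    rw [hT, LinearMap.sum_apply]
    refine Finset.sum_congr rfl fun j _ => ?_
    simp [smul_smul]
  rw [← hTx]
  suffices hS : ∀ i, ((1 - P) * A * P) (EuclideanSpace.single i 1) =
      T (EuclideanSpace.single i 1) by
    rw [euclidean_eq_sum_single x, map_sum, map_sum]
    refine Finset.sum_congr rfl fun i _ => ?_
    rw [map_smul, map_smul, hS]
  rintro ⟨j, a⟩
  set e : BlockSpace n := EuclideanSpace.single ⟨j, a⟩ 1 with he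
  have hle : ∀ b, level (weight n β) b e = if β j = b then e else 0 := by
    intro b
    ext l
    rw [level_apply]
    by_cases hl : l = ⟨j, a⟩
    · subst hl
      by_cases hb : β j = b
      · rw [if_pos hb]
        exact if_pos hb
      · rw [if_neg hb]
        exact if_neg hb
    · split_ifs <;> simp [he, hl]
  have hPe : level (weight n β) (β j) (P e) = P e := by
    rw [hP, ← hW.graded.starProjection_level, hle, if_pos rfl]
  have hinner : ∀ l : J, (l : Fin k) ≠ j → inner ℝ (u l) e = 0 := by
    intro l hl
    have hne : β j ≠ β l := (h.isolated l (hW.size_eq_two l l.2) j hl.symm).symm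
    rw [← hlev l, inner_level_left, hle, if_neg hne, inner_zero_right]
  simp only [mul_apply_eq_comp, sub_apply, one_apply_eq_self]
  rcases h.size j with hj | hj
  · -- on a real level the operator is scalar
    have hAe : A (P e) = β j • P e := by
      ext ⟨l, c⟩
      have hPl := congrArg (fun y : BlockSpace n => y ⟨l, c⟩) hPe
      simp only [level_apply] at hPl
      rw [PiLp.smul_apply, smul_eq_mul]
      by_cases hβ : β l = β j
      · have hl : n l = 1 := by
          rcases h.size l with hl | hl
          · exact hl
          · exact absurd hβ (h.isolated l hl j (fun hjl => by subst hjl; omega))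
        rw [hA, schurOp_apply_of_size_eq_one hl, hβ]
      · have hβ' : weight n β ⟨l, c⟩ ≠ β j := hβ
        rw [if_neg hβ'] at hPl
        have hlA := congrArg (fun y : BlockSpace n => y ⟨l, c⟩)
          (level_schurOp n β β ω ρ (β j) (P e))
        rw [hPe] at hlA
        simp only [level_apply, if_neg hβ'] at hlA
        rw [← hPl, mul_zero, hA, ← hlA]
    rw [hAe, map_smul, hPmem _ (W.starProjection_apply_mem e), sub_self, hTx]
    refine (Finset.sum_eq_zero fun l _ => ?_).symm
    rw [hinner l (fun hl => by have := hW.size_eq_two l l.2; rw [hl] at this; omega), mul_zero,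
      zero_smul]
  · have hPm : P e ∈ W.map (level (weight n β) (β j)) :=
      ⟨P e, W.starProjection_apply_mem e, hPe⟩
    by_cases hjJ : j ∈ J
    · -- on the line the operator is the rank-one operator
      rw [hW.line j hjJ] at hPm
      obtain ⟨c, hc⟩ : ∃ c : ℝ, P e = c • u ⟨j, hjJ⟩ := by
        obtain ⟨c, hc⟩ := Submodule.mem_span_singleton.1 hPm
        set q := Real.cos (φ j) ^ 2 + ρ j ^ 2 * Real.sin (φ j) ^ 2 with hq
        have hq0 : √q ≠ 0 := (Real.sqrt_pos.2 (cos_sq_add_mul_sin_sq_pos (hρ j hjJ) (φ j))).ne'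
        refine ⟨c * √q, ?_⟩
        rw [← hc, hu]
        dsimp only
        rw [ellipseUnit, ← hq, smul_smul, mul_assoc, mul_inv_cancel₀ hq0, mul_one]
      have hPu : P (u ⟨j, hjJ⟩) = u ⟨j, hjJ⟩ := hPmem _ (hW.ellipseUnit_mem hjJ)
      have hcin : inner ℝ (u ⟨j, hjJ⟩) e = c := by
        have h1 : inner ℝ (u ⟨j, hjJ⟩) (e - P e) = 0 := by
          rw [real_inner_comm]
          exact Submodule.starProjection_inner_eq_zero _ _ (hW.ellipseUnit_mem hjJ)
        rw [inner_sub_right, sub_eq_zero, hc, inner_smul_right, real_inner_self_eq_norm_sq,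
          hou.1] at h1
        simpa using h1
      obtain ⟨α, hα⟩ := exists_schurOp_ellipseUnit_eq hj (hρ j hjJ) β ω (φ j)
      have hα' : A (u ⟨j, hjJ⟩) = α • u ⟨j, hjJ⟩ +
        ellipseSpeed (ρ j) (ω j) (φ j) • w ⟨j, hjJ⟩ := hα
      rw [hTx, Finset.sum_eq_single (⟨j, hjJ⟩ : J)]
      · rw [hcin, hc, map_smul, hα', map_smul, map_add, map_smul, map_smul, hPu, hPw, smul_zero,
          add_zero, ← smul_sub, add_sub_cancel_left, smul_smul, mul_comm]
      · intro l _ hl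
        rw [hinner l (fun h3 => hl (Subtype.ext h3)), mul_zero, zero_smul]
      · simp
    · have hTe : T e = 0 := by
        rw [hTx]
        refine Finset.sum_eq_zero fun l _ => ?_
        rw [hinner l (fun hl => hjJ (hl ▸ l.2)), mul_zero, zero_smul]
      rw [hTe]
      rcases hW.rest j hj hjJ with h3 | h3
      · rw [h3, Submodule.mem_bot] at hPm
        simp [hPm]
      · have h4 : A (P e) ∈ W.map (level (weight n β) (β j)) := by
          rw [h3]
          refine ⟨A (P e), ?_⟩
          rw [hA, level_schurOp, hPe]
        obtain ⟨y, hy, hyA⟩ := h4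
        have h5 : A (P e) ∈ W := hyA ▸ hW.graded _ y hy
        rw [hPmem _ h5, sub_self]

end Profile

/-! ### Which profiles occur -/

section Realization

variable {k : ℕ} {n : Fin k → ℕ} {β ω ρ : Fin k → ℝ}

theorem mem_complexIndices {j : Fin k} : j ∈ complexIndices n ↔ n j = 2 := by
  simp [complexIndices]

theorem mem_admissible {d s : ℕ} {J : Finset (Fin k)} :
    J ∈ admissible d n s ↔ J ⊆ complexIndices n ∧ J.card ≤ min s (d - s) ∧
      ((complexIndices n).card = k → Even (s - J.card)) := by
  simp [admissible]

theorem finrank_blockSpace (n : Fin k → ℕ) : Module.finrank ℝ (BlockSpace n) = ∑ j, n j := by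
  simp

theorem finrank_range_level (h : IsSchurData n β ω ρ) {j : Fin k} (hj : n j = 2) :
    Module.finrank ℝ (LinearMap.range (level (weight n β) (β j))) = 2 := by
  set f : (Fin 2 → ℝ) →ₗ[ℝ] BlockSpace n :=
    { toFun := fun c => blockVec n j (c 0) (c 1)
      map_add' := fun c d => by simp [blockVec_add]
      map_smul' := fun r c => by simp [smul_blockVec] } with hf
  have hinj : Function.Injective f := by
    rw [← LinearMap.ker_eq_bot, LinearMap.ker_eq_bot']
    intro c hc
    have hc' : blockVec n j (c 0) (c 1) = 0 := hc
    have h0 := inner_blockVec_blockVec hj (c 0) (c 1) (c 0) (c 1)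
    rw [hc', inner_zero_left] at h0
    have h1 : c 0 = 0 := by nlinarith [mul_self_nonneg (c 0), mul_self_nonneg (c 1)]
    have h2 : c 1 = 0 := by nlinarith [mul_self_nonneg (c 0), mul_self_nonneg (c 1)]
    ext i
    fin_cases i
    · exact h1
    · exact h2
  have hrange : LinearMap.range (level (weight n β) (β j)) = LinearMap.range f := by
    refine le_antisymm ?_ ?_
    · rintro _ ⟨x, rfl⟩
      rw [level_eq_blockVec h hj]
      exact ⟨![_, _], rfl⟩
    · rintro _ ⟨c, rfl⟩
      exact ⟨blockVec n j (c 0) (c 1), by rw [level_blockVec, if_pos rfl]; rfl⟩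
  rw [hrange, LinearMap.finrank_range_of_inj hinj]
  simp

/-- If all blocks have size two, the blocks are the levels, and the dimension of a graded subspace
is the sum of those of its components. -/
theorem IsGraded.finrank_eq_sum (h : IsSchurData n β ω ρ) (h2 : ∀ j, n j = 2)
    {W : Submodule ℝ (BlockSpace n)} (hW : IsGraded (weight n β) W) :
    Module.finrank ℝ W = ∑ j, Module.finrank ℝ (W.map (level (weight n β) (β j))) := by
  have hsum : ∀ x : BlockSpace n, ∑ j, level (weight n β) (β j) x = x := by
    intro x
    ext ⟨l, c⟩
    rw [WithLp.ofLp_sum, Finset.sum_apply, Finset.sum_eq_single l]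
    · simp [weight]
    · intro j _ hj
      have : β l ≠ β j := h.isolated l (h2 l) j hj
      simp [weight, this]
    · simp
  set f : W →ₗ[ℝ] ∀ j, W.map (level (weight n β) (β j)) :=
    LinearMap.pi fun j => (level (weight n β) (β j)).submoduleMap W with hf
  have hfapp : ∀ w j, (f w j : BlockSpace n) = level (weight n β) (β j) w := fun w j => rfl
  have hinj : Function.Injective f := by
    intro x y hxy
    refine Subtype.ext ?_
    rw [← hsum x, ← hsum y]
    refine Finset.sum_congr rfl fun j _ => ?_
    rw [← hfapp, ← hfapp, hxy]
  have hsurj : Function.Surjective f := by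
    intro y
    have hy : ∀ j, (y j : BlockSpace n) ∈ W := by
      intro j
      obtain ⟨x, hx, hxy⟩ := (y j).2
      exact hxy ▸ hW _ x hx
    refine ⟨⟨∑ j, (y j : BlockSpace n), W.sum_mem fun j _ => hy j⟩, ?_⟩
    ext1 j
    refine Subtype.ext ?_
    rw [hfapp]
    dsimp only
    rw [map_sum, Finset.sum_eq_single j]
    · obtain ⟨x, hx, hxy⟩ := (y j).2
      rw [← hxy, level_level, if_pos rfl]
    · intro l _ hl
      obtain ⟨x, hx, hxy⟩ := (y l).2
      rw [← hxy, level_level, if_neg (h.isolated j (h2 j) l hl)]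
    · simp
  rw [(LinearEquiv.ofBijective f ⟨hinj, hsurj⟩).finrank_eq, Module.finrank_pi_fintype]

theorem HasProfile.mem_admissible (h : IsSchurData n β ω ρ) {W : Submodule ℝ (BlockSpace n)}
    {J : Finset (Fin k)} {φ : Fin k → ℝ} (hW : HasProfile n β ρ W J φ) :
    J ∈ admissible (∑ j, n j) n (Module.finrank ℝ W) := by
  have hρ : ∀ j ∈ J, ρ j ≠ 0 := fun j hj => (h.rho_pos j (hW.size_eq_two j hj)).ne'
  have h1 : J.card ≤ Module.finrank ℝ W := by
    have hli : LinearIndependent ℝ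
        (fun j : J => (⟨ellipseUnit n ρ j (φ j), hW.ellipseUnit_mem j.2⟩ : W)) := by
      refine LinearIndependent.of_comp W.subtype ?_
      exact (orthonormal_ellipseUnit hW.size_eq_two hρ φ).linearIndependent
    simpa using hli.fintype_card_le_finrank
  have h2 : J.card ≤ Module.finrank ℝ Wᗮ := by
    have hmem : ∀ j : J, ellipseNormal n ρ j (φ j) ∈ Wᗮ := fun j =>
      (Submodule.mem_orthogonal' _ _).2 fun x hx => hW.inner_ellipseNormal j.2 hx
    have hli : LinearIndependent ℝ
        (fun j : J => (⟨ellipseNormal n ρ j (φ j), hmem j⟩ : (Wᗮ : Submodule ℝ _))) := by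
      refine LinearIndependent.of_comp (Wᗮ : Submodule ℝ _).subtype ?_
      exact (orthonormal_ellipseNormal hW.size_eq_two hρ φ).linearIndependent
    simpa using hli.fintype_card_le_finrank
  have h3 := W.finrank_add_finrank_orthogonal
  rw [finrank_blockSpace] at h3
  refine AngularValue.mem_admissible.2 ⟨fun j hj => mem_complexIndices.2 (hW.size_eq_two j hj),
    le_min h1 (by omega), fun hk => ?_⟩
  have hall : ∀ j, n j = 2 := by
    intro j
    have : complexIndices n = Finset.univ := Finset.eq_univ_of_card _ (by simpa using hk)
    exact mem_complexIndices.1 (this ▸ Finset.mem_univ j)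
  rw [hW.graded.finrank_eq_sum h hall]
  have hone : ∀ j ∈ J, Module.finrank ℝ (W.map (level (weight n β) (β j))) = 1 := by
    intro j hj
    rw [hW.line j hj, finrank_span_singleton]
    intro h0
    have : ‖ellipseUnit n ρ j (φ j)‖ = 1 :=
      (orthonormal_ellipseUnit hW.size_eq_two hρ φ).1 ⟨j, hj⟩
    rw [ellipseUnit, h0] at this
    simp at this
  rw [← Finset.sum_add_sum_compl J, Finset.sum_congr rfl hone, Finset.sum_const, smul_eq_mul,
    mul_one, Nat.add_sub_cancel_left]
  refine Finset.even_sum _ fun j hj => ?_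
  rcases hW.rest j (hall j) (Finset.mem_compl.1 hj) with h0 | h0
  · rw [h0]; simp
  · rw [h0, finrank_range_level h (hall j)]
    exact even_two

/-- The dimensions left after the choice of the lines can be filled with complete blocks. -/
theorem exists_finset_sum_size_eq (hsize : ∀ j, n j = 1 ∨ n j = 2) {s : ℕ} (hs : s ≤ ∑ j, n j)
    {J : Finset (Fin k)} (hJ : J ∈ admissible (∑ j, n j) n s) :
    ∃ B : Finset (Fin k), Disjoint J B ∧ J.card + ∑ j ∈ B, n j = s := by
  obtain ⟨hJC, hcard, heven⟩ := AngularValue.mem_admissible.1 hJ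
  set C := complexIndices n with hC
  have hC2 : ∀ j ∈ C, n j = 2 := fun j hj => mem_complexIndices.1 hj
  have hC1 : ∀ j ∈ Cᶜ, n j = 1 := fun j hj =>
    (hsize j).resolve_right fun h => Finset.mem_compl.1 hj (mem_complexIndices.2 h)
  have hd : ∑ j, n j = 2 * C.card + Cᶜ.card := by
    rw [← Finset.sum_add_sum_compl C, Finset.sum_congr rfl hC2, Finset.sum_congr rfl hC1]
    simp [mul_comm]
  have hCk : C.card + Cᶜ.card = k := by
    rw [Finset.card_add_card_compl, Fintype.card_fin]
  have hCJ : (C \ J).card = C.card - J.card := Finset.card_sdiff_of_subset hJC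
  have hJle : J.card ≤ C.card := Finset.card_le_card hJC
  set m := s - J.card with hm
  have hms : J.card ≤ s := hcard.trans (min_le_left _ _)
  have hms' : J.card ≤ ∑ j, n j - s := hcard.trans (min_le_right _ _)
  obtain ⟨B₂, hB₂, hB₂c⟩ := Finset.exists_subset_card_eq
    (show min (C \ J).card (m / 2) ≤ (C \ J).card from min_le_left _ _)
  have hb : m - 2 * min (C \ J).card (m / 2) ≤ Cᶜ.card := by
    rcases le_total (C \ J).card (m / 2) with hle | hle
    · rw [min_eq_left hle]
      omega
    · rw [min_eq_right hle]
      by_cases hk : C.card = k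
      · have := Nat.even_iff.1 (heven hk)
        omega
      · omega
  obtain ⟨B₁, hB₁, hB₁c⟩ := Finset.exists_subset_card_eq hb
  have hdisj : Disjoint B₂ B₁ := by
    refine Finset.disjoint_left.2 fun j hj2 hj1 => ?_
    exact Finset.mem_compl.1 (hB₁ hj1) (Finset.mem_sdiff.1 (hB₂ hj2)).1
  refine ⟨B₂ ∪ B₁, ?_, ?_⟩
  · refine Finset.disjoint_left.2 fun j hjJ hj => ?_
    rcases Finset.mem_union.1 hj with hj | hj
    · exact (Finset.mem_sdiff.1 (hB₂ hj)).2 hjJ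
    · exact Finset.mem_compl.1 (hB₁ hj) (hJC hjJ)
  · have h2 : ∑ j ∈ B₂, n j = B₂.card * 2 := by
      rw [Finset.sum_congr rfl fun j hj => hC2 j (Finset.mem_sdiff.1 (hB₂ hj)).1]
      simp
    have h1 : ∑ j ∈ B₁, n j = B₁.card := by
      rw [Finset.sum_congr rfl fun j hj => hC1 j (hB₁ hj)]
      simp
    rw [Finset.sum_union hdisj, h1, h2, hB₁c, hB₂c]
    have := min_le_right (C \ J).card (m / 2)
    omega

/-- Every admissible index set and all phases occur: take the lines with these phases together
with complete blocks. -/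
theorem exists_hasProfile_of_mem_admissible (h : IsSchurData n β ω ρ) {s : ℕ}
    (hs : s ≤ ∑ j, n j) {J : Finset (Fin k)} (hJ : J ∈ admissible (∑ j, n j) n s)
    (φ : Fin k → ℝ) : ∃ W, HasProfile n β ρ W J φ ∧ Module.finrank ℝ W = s := by
  obtain ⟨B, hJB, hsum⟩ := exists_finset_sum_size_eq h.size hs hJ
  have hJ2 : ∀ j ∈ J, n j = 2 := fun j hj =>
    mem_complexIndices.1 ((AngularValue.mem_admissible.1 hJ).1 hj)
  have hρ : ∀ j ∈ J, ρ j ≠ 0 := fun j hj => (h.rho_pos j (hJ2 j hj)).ne'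
  have hou := orthonormal_ellipseUnit hJ2 hρ φ
  set f : J ⊕ {i : Σ j, Fin (n j) // i.1 ∈ B} → BlockSpace n :=
    Sum.elim (fun j => ellipseUnit n ρ j (φ j)) (fun i => EuclideanSpace.single i.1 1) with hf
  have hcross : ∀ (j : J) (i : {i : Σ j, Fin (n j) // i.1 ∈ B}),
      inner ℝ (ellipseUnit n ρ j (φ j)) (EuclideanSpace.single i.1 (1 : ℝ)) = 0 := by
    intro j i
    have hne : i.1.1 ≠ j := fun hij => Finset.disjoint_left.1 hJB j.2 (hij ▸ i.2)
    rw [EuclideanSpace.inner_single_right]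
    simp [ellipseUnit, ellipseVec, blockVec_apply, hne]
  have hof : Orthonormal ℝ f := by
    rw [orthonormal_iff_ite]
    rintro (i | i) (j | j)
    · simpa [hf] using (orthonormal_iff_ite.1 hou) i j
    · simpa [hf] using hcross i j
    · rw [real_inner_comm]
      simpa [hf] using hcross j i
    · simp [hf, EuclideanSpace.inner_single_left, PiLp.single_apply, Subtype.ext_iff]
  set wt : J ⊕ {i : Σ j, Fin (n j) // i.1 ∈ B} → Fin k :=
    Sum.elim (fun j => j) (fun i => i.1.1) with hwt
  have hlev : ∀ b x, level (weight n β) b (f x) = if β (wt x) = b then f x else 0 := by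
    rintro b (j | i)
    · simp only [hf, hwt, Sum.elim_inl]
      rw [ellipseUnit, map_smul, ellipseVec, level_blockVec]
      split_ifs <;> simp
    · simp only [hf, hwt, Sum.elim_inr]
      ext l
      rw [level_apply]
      by_cases hl : l = i.1
      · subst hl
        by_cases hb : β i.1.1 = b
        · rw [if_pos hb]
          exact if_pos hb
        · rw [if_neg hb]
          exact if_neg hb
      · split_ifs <;> simp [hl]
  set W := Submodule.span ℝ (Set.range f) with hW
  have hmap : ∀ b, W.map (level (weight n β) b) =
      Submodule.span ℝ (Set.range fun x => if β (wt x) = b then f x else 0) := by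
    intro b
    rw [hW, Submodule.map_span, ← Set.range_comp]
    congr 2
    ext1 x
    exact hlev b x
  have hiso : ∀ j, n j = 2 → ∀ x, β (wt x) = β j → wt x = j := by
    intro j hj x hx
    by_contra hne
    exact h.isolated j hj _ hne hx.symm
  have hfW : ∀ x, f x ∈ W := fun x => Submodule.subset_span ⟨x, rfl⟩
  refine ⟨W, ⟨?_, hJ2, ?_, ?_⟩, ?_⟩
  · intro b x hx
    have hle : W.map (level (weight n β) b) ≤ W := by
      rw [hmap, Submodule.span_le]
      rintro _ ⟨y, rfl⟩
      dsimp only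
      split_ifs
      · exact hfW y
      · exact W.zero_mem
    exact hle ⟨x, hx, rfl⟩
  · intro j hj
    have hq := (Real.sqrt_pos.2 (cos_sq_add_mul_sin_sq_pos (hρ j hj) (φ j))).ne'
    rw [← Submodule.span_singleton_smul_eq (IsUnit.mk0 _ (inv_ne_zero hq)) (ellipseVec n ρ j (φ j)),
      hmap]
    refine le_antisymm (Submodule.span_le.2 ?_) ((Submodule.span_singleton_le_iff_mem _ _).2 ?_)
    · rintro _ ⟨x, rfl⟩
      dsimp only
      split_ifs with hx
      · have hxj := hiso j (hJ2 j hj) x hx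
        rcases x with l | i
        · have hl : (l : Fin k) = j := hxj
          subst hl
          exact Submodule.mem_span_singleton_self _
        · exact absurd i.2 (Finset.disjoint_left.1 hJB (by rw [show i.1.1 = j from hxj]; exact hj))
      · exact Submodule.zero_mem _
    · refine Submodule.subset_span ⟨Sum.inl ⟨j, hj⟩, ?_⟩
      exact if_pos rfl
  · intro j hj hjJ
    by_cases hjB : j ∈ B
    · right
      refine le_antisymm ?_ ?_
      · rintro _ ⟨x, _, rfl⟩
        exact LinearMap.mem_range_self _ _
      · rintro _ ⟨x, rfl⟩
        have hmem : ∀ a, (EuclideanSpace.single ⟨j, a⟩ 1 : BlockSpace n) ∈ W := fun a =>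
          hfW (Sum.inr ⟨⟨j, a⟩, hjB⟩)
        have h10 := hmem ⟨0, by omega⟩
        have h01 := hmem ⟨1, by omega⟩
        rw [single_eq_blockVec hj] at h10 h01
        refine ⟨level (weight n β) (β j) x, ?_, by rw [level_level, if_pos rfl]⟩
        rw [level_eq_blockVec h hj]
        have hsplit : ∀ a b : ℝ,
            blockVec n j a b = a • blockVec n j 1 0 + b • blockVec n j 0 1 := by
          intro a b
          simp [smul_blockVec, blockVec_add]
        rw [hsplit]
        exact add_mem (W.smul_mem _ (by simpa using h10)) (W.smul_mem _ (by simpa using h01))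
    · left
      rw [hmap, Submodule.span_eq_bot]
      rintro _ ⟨x, rfl⟩
      refine if_neg fun hx => ?_
      have hxj := hiso j hj x hx
      rcases x with l | i
      · exact hjJ ((show (l : Fin k) = j from hxj) ▸ l.2)
      · exact hjB ((show i.1.1 = j from hxj) ▸ i.2)
  · rw [hW, finrank_span_eq_card hof.linearIndependent, Fintype.card_sum, Fintype.card_coe,
      ← hsum]
    congr 1
    have hfil : (Finset.univ.filter fun i : Σ j, Fin (n j) => i.1 ∈ B) =
        B.sigma fun _ => Finset.univ := by
      ext i
      simp
    rw [Fintype.card_subtype, hfil, Finset.card_sigma]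
    simp

end Realization

/-! ### Equidistribution of linear flows on the torus -/

section Equidistribution

theorem tendsto_zero_of_dense_span {E : Type*} [NormedAddCommGroup E] [NormedSpace ℂ E]
    {Λ : ℝ → E →ₗ[ℂ] ℂ} {C : ℝ} (hΛ : ∀ᶠ T in atTop, ∀ x, ‖Λ T x‖ ≤ C * ‖x‖) {s : Set E}
    (hs : (Submodule.span ℂ s).topologicalClosure = ⊤)
    (h : ∀ x ∈ s, Tendsto (fun T => Λ T x) atTop (𝓝 0)) (x : E) :
    Tendsto (fun T => Λ T x) atTop (𝓝 0) := by
  have hspan : ∀ y ∈ Submodule.span ℂ s, Tendsto (fun T => Λ T y) atTop (𝓝 0) := by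
    intro y hy
    induction hy using Submodule.span_induction with
    | mem y hy => exact h y hy
    | zero => simp
    | add y z _ _ hy hz => simpa using hy.add hz
    | smul c y _ hy => simpa using hy.const_mul c
  have hx : x ∈ closure (Submodule.span ℂ s : Set E) := by
    rw [← Submodule.topologicalClosure_coe, hs]
    trivial
  rw [Metric.tendsto_nhds]
  intro ε hε
  obtain ⟨y, hy, hxy⟩ := Metric.mem_closure_iff.1 hx (ε / (2 * (|C| + 1))) (by positivity)
  have hy0 := Metric.tendsto_nhds.1 (hspan y hy) (ε / 2) (by positivity)
  filter_upwards [hΛ, hy0] with T hT hTy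
  rw [dist_zero_right] at hTy ⊢
  have h1 : Λ T x = Λ T (x - y) + Λ T y := by rw [map_sub]; ring
  have h2 : ‖Λ T (x - y)‖ ≤ ε / 2 := by
    rw [dist_eq_norm, lt_div_iff₀ (by positivity)] at hxy
    refine (hT _).trans ?_
    have h3 : C * ‖x - y‖ ≤ (|C| + 1) * ‖x - y‖ := by
      gcongr
      linarith [le_abs_self C]
    linarith
  rw [h1]
  exact (norm_add_le _ _).trans_lt (by linarith)

variable {κ : Type*}

/-- The parametrization of the standard torus by phases, which have period `π`. -/
noncomputable def torusMk (τ : κ → ℝ) : UnitAddTorus κ :=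
  fun j => ((τ j / Real.pi : ℝ) : UnitAddCircle)

theorem continuous_torusMk : Continuous (torusMk : (κ → ℝ) → UnitAddTorus κ) :=
  continuous_pi fun j => (AddCircle.continuous_mk' (1 : ℝ)).comp
    ((continuous_apply j).div_const _)

variable [Fintype κ]

theorem fourier_div_pi (m : ℤ) (x : ℝ) :
    fourier m ((x / Real.pi : ℝ) : UnitAddCircle) = Complex.exp (2 * Complex.I * m * x) := by
  rw [fourier_coe_apply]
  congr 1
  have : (Real.pi : ℂ) ≠ 0 := by exact_mod_cast Real.pi_ne_zero
  push_cast
  field_simp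

theorem setIntegral_fourier_div_pi (m : ℤ) :
    ∫ x in Set.Icc (0 : ℝ) Real.pi, fourier m ((x / Real.pi : ℝ) : UnitAddCircle) =
      if m = 0 then (Real.pi : ℂ) else 0 := by
  rw [integral_Icc_eq_integral_Ioc, ← intervalIntegral.integral_of_le Real.pi_pos.le]
  simp only [fourier_div_pi]
  split_ifs with hm
  · simp [hm]
  · have hc : (2 * Complex.I * m : ℂ) ≠ 0 := by
      simp [hm]
    rw [integral_exp_mul_complex hc]
    have : Complex.exp (2 * Complex.I * m * Real.pi) = 1 := by
      rw [Complex.exp_eq_one_iff]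
      exact ⟨m, by ring⟩
    simp [this]

theorem volume_phaseBox :
    volume (Set.univ.pi fun _ : κ => Set.Icc (0 : ℝ) Real.pi) =
      ENNReal.ofReal (Real.pi ^ Fintype.card κ) := by
  rw [volume_pi_pi]
  simp [ENNReal.ofReal_pow Real.pi_pos.le]

theorem setIntegral_mFourier_torusMk (m : κ → ℤ) :
    ∫ τ in Set.univ.pi (fun _ : κ => Set.Icc (0 : ℝ) Real.pi), UnitAddTorus.mFourier m (torusMk τ) =
      if m = 0 then (Real.pi : ℂ) ^ Fintype.card κ else 0 := by
  rw [volume_pi, Measure.restrict_pi_pi]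
  have h := integral_fintype_prod_eq_prod (𝕜 := ℂ)
    (fun (j : κ) (x : ℝ) => fourier (m j) ((x / Real.pi : ℝ) : UnitAddCircle))
    (μ := fun _ => volume.restrict (Set.Icc (0 : ℝ) Real.pi))
  refine Eq.trans h ?_
  simp only [setIntegral_fourier_div_pi]
  split_ifs with hm
  · simp [hm]
  · obtain ⟨j, hj⟩ := Function.ne_iff.1 hm
    exact Finset.prod_eq_zero (Finset.mem_univ j) (if_neg hj)

/-- The deviation of the time average over `[0, T]` of a function on the torus, along the linear
flow with frequencies `a` and initial phases `φ`, from its mean. -/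
noncomputable def averageDefect (a φ : κ → ℝ) (T : ℝ) : C(UnitAddTorus κ, ℂ) →ₗ[ℂ] ℂ where
  toFun f := ((1 / T : ℝ) : ℂ) * (∫ t in (0 : ℝ)..T, f (torusMk fun j => φ j + a j * t)) -
    ((1 / Real.pi ^ Fintype.card κ : ℝ) : ℂ) *
      ∫ τ in Set.univ.pi (fun _ : κ => Set.Icc (0 : ℝ) Real.pi), f (torusMk τ)
  map_add' f g := by
    have hc : ∀ f : C(UnitAddTorus κ, ℂ),
        Continuous fun t : ℝ => f (torusMk fun j => φ j + a j * t) := fun f =>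
      f.continuous.comp (continuous_torusMk.comp (by fun_prop))
    have hi : ∀ f : C(UnitAddTorus κ, ℂ), IntegrableOn (fun τ => f (torusMk τ))
        (Set.univ.pi (fun _ : κ => Set.Icc (0 : ℝ) Real.pi)) volume := fun f =>
      (f.continuous.comp continuous_torusMk).continuousOn.integrableOn_compact
        (isCompact_univ_pi fun _ => isCompact_Icc)
    simp only [ContinuousMap.add_apply]
    rw [intervalIntegral.integral_add ((hc f).intervalIntegrable _ _)
      ((hc g).intervalIntegrable _ _), integral_add (hi f) (hi g)]
    ring
  map_smul' c f := by
    simp only [ContinuousMap.smul_apply, smul_eq_mul, RingHom.id_apply,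
      intervalIntegral.integral_const_mul, integral_const_mul]
    ring

theorem norm_averageDefect_le (a φ : κ → ℝ) {T : ℝ} (hT : 0 < T) (f : C(UnitAddTorus κ, ℂ)) :
    ‖averageDefect a φ T f‖ ≤ 2 * ‖f‖ := by
  have h1 : ‖∫ t in (0 : ℝ)..T, f (torusMk fun j => φ j + a j * t)‖ ≤ ‖f‖ * T := by
    have := intervalIntegral.norm_integral_le_of_norm_le_const (a := 0) (b := T)
      (f := fun t : ℝ => f (torusMk fun j => φ j + a j * t)) (C := ‖f‖)
      fun x _ => f.norm_coe_le_norm _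
    rwa [sub_zero, abs_of_pos hT] at this
  have h2 : ‖∫ τ in Set.univ.pi (fun _ : κ => Set.Icc (0 : ℝ) Real.pi), f (torusMk τ)‖ ≤
      ‖f‖ * Real.pi ^ Fintype.card κ := by
    have := norm_setIntegral_le_of_norm_le_const (μ := volume)
      (s := Set.univ.pi (fun _ : κ => Set.Icc (0 : ℝ) Real.pi))
      (f := fun τ => f (torusMk τ)) (C := ‖f‖)
      (by rw [volume_phaseBox]; exact ENNReal.ofReal_lt_top)
      fun x _ => f.norm_coe_le_norm _
    rwa [measureReal_def, volume_phaseBox, ENNReal.toReal_ofReal (by positivity)] at this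
  have hp : 0 < Real.pi ^ Fintype.card κ := by positivity
  change ‖((1 / T : ℝ) : ℂ) * _ - ((1 / Real.pi ^ Fintype.card κ : ℝ) : ℂ) * _‖ ≤ _
  refine (norm_sub_le _ _).trans ?_
  rw [norm_mul, norm_mul, Complex.norm_real, Complex.norm_real, Real.norm_eq_abs,
    Real.norm_eq_abs, abs_of_pos (by positivity), abs_of_pos (by positivity), one_div, one_div,
    two_mul]
  refine add_le_add ?_ ?_
  · rw [inv_mul_le_iff₀ hT, mul_comm]
    exact h1
  · rw [inv_mul_le_iff₀ hp, mul_comm]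
    exact h2

theorem tendsto_averageDefect_mFourier {a : κ → ℝ} (ha : LinearIndependent ℤ a) (φ : κ → ℝ)
    (m : κ → ℤ) :
    Tendsto (fun T => averageDefect a φ T (UnitAddTorus.mFourier m)) atTop (𝓝 0) := by
  set c : ℂ := 2 * Complex.I * (∑ j, (m j : ℝ) * a j : ℝ) with hc
  set b : ℂ := Complex.exp (2 * Complex.I * (∑ j, (m j : ℝ) * φ j : ℝ)) with hb
  have hval : ∀ t : ℝ, UnitAddTorus.mFourier m (torusMk fun j => φ j + a j * t) =
      b * Complex.exp (c * t) := by
    intro t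
    change ∏ j, fourier (m j) (((φ j + a j * t) / Real.pi : ℝ) : UnitAddCircle) = _
    simp only [fourier_div_pi]
    rw [← Complex.exp_sum, hb, ← Complex.exp_add]
    congr 1
    rw [hc]
    push_cast
    rw [Finset.mul_sum, Finset.mul_sum, Finset.sum_mul, ← Finset.sum_add_distrib]
    refine Finset.sum_congr rfl fun j _ => ?_
    ring
  have hdef : ∀ T, averageDefect a φ T (UnitAddTorus.mFourier m) =
      ((1 / T : ℝ) : ℂ) * (b * ∫ t in (0 : ℝ)..T, Complex.exp (c * t)) -
      ((1 / Real.pi ^ Fintype.card κ : ℝ) : ℂ) *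
        if m = 0 then (Real.pi : ℂ) ^ Fintype.card κ else 0 := by
    intro T
    rw [← setIntegral_mFourier_torusMk, ← intervalIntegral.integral_const_mul]
    simp only [← hval]
    rfl
  have hpi : (Real.pi : ℂ) ≠ 0 := by exact_mod_cast Real.pi_ne_zero
  simp only [hdef]
  by_cases hm : m = 0
  · have hc0 : c = 0 := by simp [hc, hm]
    have hb1 : b = 1 := by simp [hb, hm]
    refine tendsto_const_nhds.congr' ?_
    filter_upwards [eventually_gt_atTop 0] with T hT
    have hT' : (T : ℂ) ≠ 0 := by exact_mod_cast hT.ne'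
    simp [hm, hc0, hb1, hpi, hT']
  · have hsum : ∑ j, (m j : ℝ) * a j ≠ 0 := by
      intro h0
      refine hm (funext fun j => ?_)
      exact Fintype.linearIndependent_iff.1 ha m (by simpa using h0) j
    have hc0 : c ≠ 0 := by
      rw [hc]
      refine mul_ne_zero (by simp) ?_
      exact_mod_cast hsum
    have hnorm : ∀ t : ℝ, ‖Complex.exp (c * t)‖ = 1 := by
      intro t
      have : c * t = ((2 * (∑ j, (m j : ℝ) * a j) * t : ℝ) : ℂ) * Complex.I := by
        rw [hc]; push_cast; ring
      rw [this, Complex.norm_exp_ofReal_mul_I]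
    simp only [if_neg hm, mul_zero, sub_zero]
    have hlim : Tendsto (fun T : ℝ => |1 / T| * (‖b‖ * (2 / ‖c‖))) atTop (𝓝 0) := by
      have h1 : Tendsto (fun T : ℝ => |1 / T|) atTop (𝓝 0) := by
        simpa using (tendsto_inv_atTop_zero (𝕜 := ℝ)).abs
      simpa using h1.mul_const (‖b‖ * (2 / ‖c‖))
    refine squeeze_zero_norm (fun T => ?_) hlim
    rw [norm_mul, norm_mul, Complex.norm_real, Real.norm_eq_abs, integral_exp_mul_complex hc0,
      norm_div]
    gcongr
    refine (norm_sub_le _ _).trans ?_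
    rw [hnorm, hnorm]
    norm_num

/-- **Kronecker–Weyl**: for rationally independent frequencies, time averages converge to the
mean over the torus. -/
theorem tendsto_average_torus {a : κ → ℝ} (ha : LinearIndependent ℤ a) (φ : κ → ℝ)
    {g : UnitAddTorus κ → ℝ} (hg : Continuous g) :
    Tendsto (fun T : ℝ => 1 / T * ∫ t in (0 : ℝ)..T, g (torusMk fun j => φ j + a j * t)) atTop
      (𝓝 (1 / Real.pi ^ Fintype.card κ *
        ∫ τ in Set.univ.pi (fun _ : κ => Set.Icc (0 : ℝ) Real.pi), g (torusMk τ))) := by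
  have h := tendsto_zero_of_dense_span (C := 2) (Λ := averageDefect a φ)
    ((eventually_gt_atTop 0).mono fun T hT f => norm_averageDefect_le a φ hT f)
    UnitAddTorus.span_mFourier_closure_eq_top
    (by rintro _ ⟨m, rfl⟩; exact tendsto_averageDefect_mFourier ha φ m)
    ⟨fun x => (g x : ℂ), Complex.continuous_ofReal.comp hg⟩
  have h1 : ∀ T, averageDefect a φ T ⟨fun x => (g x : ℂ), Complex.continuous_ofReal.comp hg⟩ =
      ((1 / T * (∫ t in (0 : ℝ)..T, g (torusMk fun j => φ j + a j * t)) -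
        1 / Real.pi ^ Fintype.card κ *
        ∫ τ in Set.univ.pi (fun _ : κ => Set.Icc (0 : ℝ) Real.pi), g (torusMk τ) : ℝ) : ℂ) := by
    intro T
    rw [Complex.ofReal_sub, Complex.ofReal_mul, Complex.ofReal_mul,
      ← intervalIntegral.integral_ofReal, ← integral_complex_ofReal]
    rfl
  simp only [h1] at h
  have h2 := (Complex.continuous_re.tendsto 0).comp h
  simp only [Function.comp_def, Complex.ofReal_re, Complex.zero_re] at h2
  simpa using h2.add_const (1 / Real.pi ^ Fintype.card κ *
        ∫ τ in Set.univ.pi (fun _ : κ => Set.Icc (0 : ℝ) Real.pi), g (torusMk τ))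

theorem ellipseSpeed_add_pi (r w x : ℝ) : ellipseSpeed r w (x + Real.pi) = ellipseSpeed r w x := by
  simp [ellipseSpeed]

theorem continuous_ellipseSpeed {r : ℝ} (hr : r ≠ 0) (w : ℝ) : Continuous (ellipseSpeed r w) := by
  refine Continuous.div (by fun_prop) (by fun_prop) fun φ =>
    (cos_sq_add_mul_sin_sq_pos hr φ).ne'

theorem pi_norm_eq_iSup {x : κ → ℝ} (hx : ∀ j, 0 ≤ x j) : ‖x‖ = ⨆ j, x j := by
  refine le_antisymm ?_ (Real.iSup_le (fun j => ?_) (norm_nonneg _))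
  · rw [pi_norm_le_iff_of_nonneg (Real.iSup_nonneg hx)]
    intro j
    rw [Real.norm_eq_abs, abs_of_nonneg (hx j)]
    exact le_ciSup (Set.finite_range x).bddAbove j
  · exact (le_abs_self _).trans (norm_le_pi_norm x j)

theorem tendsto_average_iSup_ellipseSpeed {r w : κ → ℝ} (hr : ∀ j, 0 < r j) (hw : ∀ j, 0 < w j)
    (hind : LinearIndependent ℤ w) (φ : κ → ℝ) :
    Tendsto (fun T : ℝ => 1 / T * ∫ t in (0 : ℝ)..T,
        ⨆ j, ellipseSpeed (r j) (w j) (φ j + w j * t)) atTop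
      (𝓝 (1 / Real.pi ^ Fintype.card κ *
        ∫ τ in Set.univ.pi (fun _ : κ => Set.Icc (0 : ℝ) Real.pi),
          ⨆ j, ellipseSpeed (r j) (w j) (τ j))) := by
  have hper : ∀ j, Function.Periodic (fun x : ℝ => ellipseSpeed (r j) (w j) (Real.pi * x)) 1 :=
    fun j x => by
      dsimp only
      rw [mul_add, mul_one, ellipseSpeed_add_pi]
  set e : κ → UnitAddCircle → ℝ := fun j => (hper j).lift with he
  have hec : ∀ j, Continuous (e j) := fun j =>
    continuous_coinduced_dom.2 ((continuous_ellipseSpeed (hr j).ne' (w j)).comp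
      (continuous_const.mul continuous_id))
  have h0 : ∀ j x, 0 ≤ ellipseSpeed (r j) (w j) x := fun j x =>
    ellipseSpeed_nonneg (hr j) (hw j) _
  have hev : ∀ τ : κ → ℝ, ‖fun j => e j (torusMk τ j)‖ =
      ⨆ j, ellipseSpeed (r j) (w j) (τ j) := by
    intro τ
    rw [← pi_norm_eq_iSup fun j => h0 j _]
    congr 1
    ext j
    change ellipseSpeed (r j) (w j) (Real.pi * (τ j / Real.pi)) = _
    rw [mul_div_cancel₀ _ Real.pi_ne_zero]
  have h := tendsto_average_torus hind φ (g := fun x => ‖fun j => e j (x j)‖)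
    (continuous_pi fun j => (hec j).comp (continuous_apply j)).norm
  simpa only [hev] using h

end Equidistribution

/-! ### Reduction of the outer angular values to profiles -/

section Reduction

variable {d k : ℕ} {A : Matrix (Fin d) (Fin d) ℝ} {n : Fin k → ℕ} {β ω ρ : Fin k → ℝ}
  {Q : Matrix (Σ j, Fin (n j)) (Fin d) ℝ}

theorem IsBlockDiagSchur.isSchurData (hA : IsBlockDiagSchur A n β ω ρ Q)
    (hiso : ∀ j ∈ complexIndices n, ∀ ν : Fin k, ν ≠ j → β j ≠ β ν) : IsSchurData n β ω ρ where
  size := hA.size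
  omega_pos := hA.omega_pos
  rho_pos := hA.rho_pos
  isolated j hj := hiso j (mem_complexIndices.2 hj)

/-- The orthogonal change of coordinates to the real Schur form. -/
noncomputable def IsBlockDiagSchur.isometry (hA : IsBlockDiagSchur A n β ω ρ Q) :
    Vec d ≃ₗᵢ[ℝ] BlockSpace n where
  toFun x := WithLp.toLp 2 (Q.mulVec x)
  invFun y := WithLp.toLp 2 (Q.transpose.mulVec y)
  map_add' x y := by simp [Matrix.mulVec_add]
  map_smul' c x := by simp [Matrix.mulVec_smul]
  left_inv x := by simp [hA.orth_right]
  right_inv y := by simp [hA.orth_left]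
  norm_map' x := by
    have h : Q.mulVec x ⬝ᵥ Q.mulVec x = x.ofLp ⬝ᵥ x.ofLp := by
      rw [Matrix.dotProduct_mulVec, ← Matrix.mulVec_transpose, Matrix.mulVec_mulVec,
        hA.orth_right, Matrix.one_mulVec]
    rw [EuclideanSpace.norm_eq, EuclideanSpace.norm_eq]
    congr 1
    simpa [dotProduct, sq] using h

theorem IsBlockDiagSchur.isometry_op (hA : IsBlockDiagSchur A n β ω ρ Q) (x : Vec d) :
    hA.isometry (op A x) = schurOp n β ω ρ (hA.isometry x) := by
  have hcomm : Q * A =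
      Matrix.blockDiagonal' (fun j => schurBlock (n j) (β j) (ω j) (ρ j)) * Q := by
    rw [← hA.schur, Matrix.mul_assoc, hA.orth_right, Matrix.mul_one]
  have h1 : (op A x).ofLp = A.mulVec x := Matrix.ofLp_toEuclideanCLM _ _
  have h2 : (schurOp n β ω ρ (hA.isometry x)).ofLp =
      (Matrix.blockDiagonal' (fun j => schurBlock (n j) (β j) (ω j) (ρ j))).mulVec
        (Q.mulVec x) := Matrix.ofLp_toEuclideanCLM _ _
  refine WithLp.ofLp_injective 2 ?_
  rw [h2]
  change Q.mulVec (op A x).ofLp = _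
  rw [h1, Matrix.mulVec_mulVec, Matrix.mulVec_mulVec, hcomm]

theorem IsBlockDiagSchur.sum_size (hA : IsBlockDiagSchur A n β ω ρ Q) : ∑ j, n j = d := by
  have h := hA.isometry.toLinearEquiv.finrank_eq
  rw [finrank_blockSpace] at h
  simpa using h.symm

theorem IsBlockDiagSchur.rotationSpeed_eq (hA : IsBlockDiagSchur A n β ω ρ Q)
    (V : Submodule ℝ (Vec d)) (t : ℝ) :
    rotationSpeed A V t = speed (schurOp n β ω ρ) (evolve (schurOp n β ω ρ)
      (V.map (hA.isometry.toLinearEquiv : Vec d →ₗ[ℝ] BlockSpace n)) t) := by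
  rw [← map_evolve_linearIsometryEquiv hA.isometry hA.isometry_op,
    speed_map_linearIsometryEquiv hA.isometry hA.isometry_op]
  rfl

/-- The average up to time `T` of the rotation speed of a graded subspace with profile
`(J, φ)`. -/
noncomputable def profileAverage (ω ρ : Fin k → ℝ) (J : Finset (Fin k)) (φ : Fin k → ℝ)
    (T : ℝ) : ℝ :=
  1 / T * ∫ t in (0 : ℝ)..T, ⨆ j : J, ellipseSpeed (ρ j) (ω j) (φ j + ω j * t)

/-- Under the flow every subspace approaches a graded one, hence rotates on average like the
profile of the latter. -/
theorem exists_profile_tendsto (hA : IsBlockDiagSchur A n β ω ρ Q) (h : IsSchurData n β ω ρ)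
    (V : Submodule ℝ (Vec d)) :
    ∃ J ∈ admissible d n (Module.finrank ℝ V), ∃ φ : Fin k → ℝ,
      Tendsto (fun T : ℝ => 1 / T * angularIntegral A V 0 T - profileAverage ω ρ J φ T) atTop
        (𝓝 0) := by
  set V' := V.map (hA.isometry.toLinearEquiv : Vec d →ₗ[ℝ] BlockSpace n) with hV'
  obtain ⟨W, R, hW, -, hR, hVW⟩ := exists_isGraded_map_eq (weight n β)
    (Finset.univ.image (weight n β)) V'
    (fun x _ i hi => absurd (Finset.mem_image_of_mem _ (Finset.mem_univ i)) hi)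
  obtain ⟨J, φ, hJ⟩ := exists_hasProfile h hW
  have hdim : Module.finrank ℝ W = Module.finrank ℝ V := by
    have h1 : Module.finrank ℝ V' = Module.finrank ℝ V :=
      LinearEquiv.finrank_map_eq hA.isometry.toLinearEquiv V
    rw [← h1, hVW]
    exact (Submodule.equivMapOfInjective _ (injective_one_add_of_lowers hR) W).finrank_eq
  have hadm := hJ.mem_admissible h
  rw [hdim, hA.sum_size] at hadm
  refine ⟨J, hadm, φ, ?_⟩
  set B := schurOp n β ω ρ with hB
  have hspeedW : ∀ t, speed B (evolve B W t) =
      ⨆ j : J, ellipseSpeed (ρ j) (ω j) (φ j + ω j * t) := fun t => (hJ.evolve h t).speed_eq h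
  have hlim := tendsto_speed_evolve_sub B (LinearMap.toContinuousLinearMap R) (V := V') (W := W)
    (by rw [hVW]; rfl) (tendsto_exp_schurOp_conj h hR)
  have hcV := continuous_speed_evolve B V'
  have hcW := continuous_speed_evolve B W
  have hc : Continuous fun t => speed B (evolve B V' t) - speed B (evolve B W t) := hcV.sub hcW
  refine (tendsto_average_of_tendsto_zero hc hlim).congr fun T => ?_
  rw [intervalIntegral.integral_sub (hcV.intervalIntegrable _ _) (hcW.intervalIntegrable _ _),
    mul_sub, angularIntegral, profileAverage]
  simp only [hA.rotationSpeed_eq, hspeedW]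
  rfl

theorem exists_finrank_eq_and_average_eq (hA : IsBlockDiagSchur A n β ω ρ Q)
    (h : IsSchurData n β ω ρ) {s : ℕ} (hs : s ≤ d) {J : Finset (Fin k)}
    (hJ : J ∈ admissible d n s) (φ : Fin k → ℝ) :
    ∃ V : Submodule ℝ (Vec d), Module.finrank ℝ V = s ∧
      ∀ T : ℝ, 1 / T * angularIntegral A V 0 T = profileAverage ω ρ J φ T := by
  obtain ⟨W, hW, hdim⟩ := exists_hasProfile_of_mem_admissible h (s := s) (by rwa [hA.sum_size])
    (by rwa [hA.sum_size]) φ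
  refine ⟨W.map (hA.isometry.symm.toLinearEquiv : BlockSpace n →ₗ[ℝ] Vec d), ?_, fun T => ?_⟩
  · rw [← hdim]
    exact LinearEquiv.finrank_map_eq hA.isometry.symm.toLinearEquiv W
  · have hVW : (W.map (hA.isometry.symm.toLinearEquiv : BlockSpace n →ₗ[ℝ] Vec d)).map
        (hA.isometry.toLinearEquiv : Vec d →ₗ[ℝ] BlockSpace n) = W := by
      rw [← Submodule.map_comp]
      convert Submodule.map_id W
      ext1 x
      exact hA.isometry.apply_symm_apply x
    rw [angularIntegral, profileAverage]
    simp only [hA.rotationSpeed_eq, hVW, (hW.evolve h _).speed_eq h]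

theorem outerLimsup_eq_iSup (hA : IsBlockDiagSchur A n β ω ρ Q) (h : IsSchurData n β ω ρ)
    {s : ℕ} (hs : s ≤ d) :
    outerLimsup A s = ⨆ (J ∈ admissible d n s) (φ : Fin k → ℝ),
      limsup (fun T => (profileAverage ω ρ J φ T : EReal)) atTop := by
  refine le_antisymm (iSup_le fun V => ?_) (iSup₂_le fun J hJ => iSup_le fun φ => ?_)
  · obtain ⟨J, hJ, φ, hlim⟩ := exists_profile_tendsto hA h V.1
    rw [V.2] at hJ
    rw [limsup_coe_eq_of_tendsto_sub hlim]
    exact le_iSup₂_of_le J hJ (le_iSup_of_le φ le_rfl)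
  · obtain ⟨V, hV, havg⟩ := exists_finrank_eq_and_average_eq hA h hs hJ φ
    refine le_iSup_of_le (⟨V, hV⟩ : Grassmannian s d) ?_
    simp only [havg, le_rfl]

theorem outerLiminf_eq_iSup (hA : IsBlockDiagSchur A n β ω ρ Q) (h : IsSchurData n β ω ρ)
    {s : ℕ} (hs : s ≤ d) :
    outerLiminf A s = ⨆ (J ∈ admissible d n s) (φ : Fin k → ℝ),
      liminf (fun T => (profileAverage ω ρ J φ T : EReal)) atTop := by
  refine le_antisymm (iSup_le fun V => ?_) (iSup₂_le fun J hJ => iSup_le fun φ => ?_)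
  · obtain ⟨J, hJ, φ, hlim⟩ := exists_profile_tendsto hA h V.1
    rw [V.2] at hJ
    rw [liminf_coe_eq_of_tendsto_sub hlim]
    exact le_iSup₂_of_le J hJ (le_iSup_of_le φ le_rfl)
  · obtain ⟨V, hV, havg⟩ := exists_finrank_eq_and_average_eq hA h hs hJ φ
    refine le_iSup_of_le (⟨V, hV⟩ : Grassmannian s d) ?_
    simp only [havg, le_rfl]

theorem IsBlockDiagSchur.eq_two_mul_of_card_eq (hA : IsBlockDiagSchur A n β ω ρ Q)
    (hk : (complexIndices n).card = k) : d = 2 * k := by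
  have huniv : complexIndices n = Finset.univ := Finset.eq_univ_of_card _ (by simpa using hk)
  have hall : ∀ j, n j = 2 := fun j => mem_complexIndices.1 (huniv ▸ Finset.mem_univ j)
  rw [← hA.sum_size]
  simp [hall, mul_comm]

/-- The condition on the lines is symmetric in a subspace and its orthogonal complement. -/
theorem admissible_sub (hA : IsBlockDiagSchur A n β ω ρ Q) {s : ℕ} (hs : s ≤ d) :
    admissible d n (d - s) = admissible d n s := by
  ext J
  rw [mem_admissible, mem_admissible, Nat.sub_sub_self hs, min_comm]
  refine and_congr_right fun _ => and_congr_right fun hc => forall_congr' fun hk => ?_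
  have hd := hA.eq_two_mul_of_card_eq hk
  rw [Nat.le_min] at hc
  rw [Nat.even_iff, Nat.even_iff]
  omega

theorem admissible_nonempty (hA : IsBlockDiagSchur A n β ω ρ Q)
    (hne : (complexIndices n).Nonempty) {s : ℕ} (hs : s ≤ d) : (admissible d n s).Nonempty := by
  by_cases he : (complexIndices n).card = k → Even s
  · exact ⟨∅, mem_admissible.2 ⟨Finset.empty_subset _, by simp, by simpa using he⟩⟩
  · rw [Classical.not_imp, Nat.even_iff] at he
    obtain ⟨j, hj⟩ := hne
    have hd := hA.eq_two_mul_of_card_eq he.1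
    refine ⟨{j}, mem_admissible.2 ⟨by simpa using hj, ?_, fun _ => ?_⟩⟩
    · rw [Finset.card_singleton, Nat.le_min]
      omega
    · rw [Finset.card_singleton, Nat.even_iff]
      omega

theorem tendsto_profileAverage (h : IsSchurData n β ω ρ) {J : Finset (Fin k)}
    (hJ : J ⊆ complexIndices n) (hind : LinearIndependent ℤ fun j : J => ω j) (φ : Fin k → ℝ) :
    Tendsto (profileAverage ω ρ J φ) atTop (𝓝 (torusMean ω ρ J)) := by
  have hJ2 : ∀ j : J, n j = 2 := fun j => mem_complexIndices.1 (hJ j.2)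
  have := tendsto_average_iSup_ellipseSpeed (fun j : J => h.rho_pos j (hJ2 j))
    (fun j : J => h.omega_pos j (hJ2 j)) hind fun j => φ j
  rw [Fintype.card_coe] at this
  exact this

end Reduction

end AngularValue

theorem mainTheorem7 {d k : ℕ} (A : Matrix (Fin d) (Fin d) ℝ) (n : Fin k → ℕ)
    (β ω ρ : Fin k → ℝ) (Q : Matrix (Σ j, Fin (n j)) (Fin d) ℝ)
    (hA : AngularValue.IsBlockDiagSchur A n β ω ρ Q)
    (hne : (AngularValue.complexIndices n).Nonempty)
    (hiso : ∀ j ∈ AngularValue.complexIndices n, ∀ ν : Fin k, ν ≠ j → β j ≠ β ν) :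
    (∀ s : ℕ, 1 ≤ s → s ≤ d - 1 →
      AngularValue.outerLimsup A s = AngularValue.outerLimsup A (d - s) ∧
      AngularValue.outerLiminf A s = AngularValue.outerLiminf A (d - s)) ∧
    (∀ s : ℕ, 1 ≤ s → s ≤ d →
      (∀ J ∈ AngularValue.admissible d n s, LinearIndependent ℤ (fun j : J => ω j)) →
      AngularValue.outerLimsup A s = AngularValue.outerLiminf A s ∧
      IsGreatest
        {x : EReal | ∃ J ∈ AngularValue.admissible d n s,
          x = (AngularValue.torusMean ω ρ J : EReal)}
        (AngularValue.outerLimsup A s)) := by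
  have h := hA.isSchurData hiso
  refine ⟨fun s _ hs => ?_, fun s _ hs hind => ?_⟩
  · have hsd : s ≤ d := hs.trans (Nat.sub_le _ _)
    rw [AngularValue.outerLimsup_eq_iSup hA h hsd,
      AngularValue.outerLimsup_eq_iSup hA h (Nat.sub_le d s),
      AngularValue.outerLiminf_eq_iSup hA h hsd,
      AngularValue.outerLiminf_eq_iSup hA h (Nat.sub_le d s), AngularValue.admissible_sub hA hsd]
    exact ⟨rfl, rfl⟩
  · have hlim : ∀ J ∈ AngularValue.admissible d n s, ∀ φ, Tendsto
        (fun T => (AngularValue.profileAverage ω ρ J φ T : EReal)) atTop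
        (𝓝 (AngularValue.torusMean ω ρ J : EReal)) := fun J hJ φ =>
      (continuous_coe_real_ereal.tendsto _).comp (AngularValue.tendsto_profileAverage h
        (AngularValue.mem_admissible.1 hJ).1 (hind J hJ) φ)
    have hsup : AngularValue.outerLimsup A s =
        ⨆ J ∈ AngularValue.admissible d n s, (AngularValue.torusMean ω ρ J : EReal) := by
      rw [AngularValue.outerLimsup_eq_iSup hA h hs]
      refine iSup_congr fun J => iSup_congr fun hJ => ?_
      simp only [(hlim J hJ _).limsup_eq, ciSup_const]
    have hinf : AngularValue.outerLiminf A s =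
        ⨆ J ∈ AngularValue.admissible d n s, (AngularValue.torusMean ω ρ J : EReal) := by
      rw [AngularValue.outerLiminf_eq_iSup hA h hs]
      refine iSup_congr fun J => iSup_congr fun hJ => ?_
      simp only [(hlim J hJ _).liminf_eq, ciSup_const]
    refine ⟨hsup.trans hinf.symm, ?_, ?_⟩
    · obtain ⟨J, hJ, hmax⟩ := Finset.exists_max_image _ (AngularValue.torusMean ω ρ)
        (AngularValue.admissible_nonempty hA hne hs)
      refine ⟨J, hJ, ?_⟩
      rw [hsup]
      exact le_antisymm (iSup₂_le fun J' hJ' => EReal.coe_le_coe_iff.2 (hmax J' hJ'))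
        (le_iSup₂_of_le J hJ le_rfl)
    · rintro _ ⟨J, hJ, rfl⟩
      rw [hsup]
      exact le_iSup₂_of_le J hJ le_rfl
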